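/- Let $p, q_1, q_2$ be primes with $p \equiv 5 \pmod 8$, $q_1 \equiv q_2 \equiv 3 \pmod 8$, $q_1 \neq q_2$, and Legendre symbols $\left(\frac{p}{q_1}\right) = \left(\frac{p}{q_2}\right) = -1$. Put $D = p q_1 q_2$, $K = \mathbb{Q}(\sqrt{D})$, $K' = \mathbb{Q}(\sqrt{2D})$, $\mathbb{Q}_1 = \mathbb{Q}(\sqrt{2})$ and $K_1 = \mathbb{Q}(\sqrt{2}, \sqrt{D})$, all regarded as subfields of $\mathbb{R}$. For $d \in \{2, D, 2D\}$ let $\varepsilon_d$ be the fundamental unit of $\mathbb{Q}(\sqrt{d})$, that is, the least unit $> 1$ of its ring of integers. A fundamental system of units of $K_1$ is a family of units of its ring of integers whose classes form a $\mathbb{Z}$-basis of the unit group modulo $\{\pm 1\}$. Square roots of positive numbers are the positive real ones. Then: 1. There is exactly one prime ideal of the ring of integers of $K$ above $p$, and it is principal. 2. Exactly one of $\{\varepsilon_D, \varepsilon_{2D}, \varepsilon_2\}$ and $\{\sqrt{\varepsilon_D \varepsilon_{2D}}, \varepsilon_D, \varepsilon_2\}$ is a fundamental system of units of $K_1$. 3.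 There are integers $r, s$ (necessarily unique) with $\varepsilon_{2D} = r + s\sqrt{2D}$, and $\sqrt{\varepsilon_D \varepsilon_{2D}} \in K_1$ if and only if $p(r+1)$ is the square of an integer. 4. If $\sqrt{\varepsilon_D \varepsilon_{2D}} \in K_1$, then $$N_{K_1/K}\left(\sqrt{\varepsilon_D \varepsilon_{2D}}\right) = -\varepsilon_D, \quad N_{K_1/K'}\left(\sqrt{\varepsilon_D \varepsilon_{2D}}\right) = \varepsilon_{2D}, \quad N_{K_1/\mathbb{Q}_1}\left(\sqrt{\varepsilon_D \varepsilon_{2D}}\right) = -1.$$ -/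

import Mathlib

open NumberField

noncomputable section

/-- The quadratic field `ℚ(√d)`, as a subfield of the real numbers. -/
def realQuadField (d : ℕ) : IntermediateField ℚ ℝ :=
  IntermediateField.adjoin ℚ {√(d : ℝ)}

/-- The field `ℚ(√2, √d)`, as a subfield of the real numbers. -/
def realBiquadField (d : ℕ) : IntermediateField ℚ ℝ :=
  IntermediateField.adjoin ℚ {√(2 : ℝ), √(d : ℝ)}

/-- The set of real numbers that are units of the ring of integers of `L ⊆ ℝ`. -/
def unitSet (L : IntermediateField ℚ ℝ) : Set ℝ :=
  {x | ∃ u : (𝓞 L)ˣ, (((u : 𝓞 L) : L) : ℝ) = x}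

/-- The fundamental unit of the real quadratic field `ℚ(√d)`: the least unit `> 1` of its ring of
integers. (For `d` not a square this set of units is nonempty and discrete, so that the infimum is
its minimum.) -/
def fundamentalUnit (d : ℕ) : ℝ :=
  sInf {x | x ∈ unitSet (realQuadField d) ∧ 1 < x}

/-- The real numbers `v i` form a fundamental system of units of `L ⊆ ℝ`: they are units of the
ring of integers of `L`, and every unit is, for exactly one choice of integer exponents `a i`, the
product of a torsion unit (a root of unity) and `∏ i, v i ^ a i`; that is, the classes of the `v i`
form a `ℤ`-basis of the group of units modulo torsion. -/
def IsFundamentalSystemOfUnits (L : IntermediateField ℚ ℝ) {ι : Type*} [Fintype ι]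
    (v : ι → ℝ) : Prop :=
  ∃ u : ι → (𝓞 L)ˣ, (∀ i, (((u i : 𝓞 L) : L) : ℝ) = v i) ∧
    ∀ w : (𝓞 L)ˣ, ∃! a : ι → ℤ, ∃ ζ ∈ NumberField.Units.torsion L, w = ζ * ∏ i, u i ^ a i

/-- The norm map `N_{L/F}` for subfields `F ⊆ L` of the real numbers. -/
def relNorm {F L : IntermediateField ℚ ℝ} (h : F ≤ L) : L →* F :=
  letI : Algebra F L := (IntermediateField.inclusion h).toRingHom.toAlgebra
  Algebra.norm F

theorem realQuadField_le (d : ℕ) : realQuadField d ≤ realBiquadField d :=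
  IntermediateField.adjoin.mono ℚ _ _ (by simp)

theorem realQuadField_two_le (d : ℕ) : realQuadField 2 ≤ realBiquadField d :=
  IntermediateField.adjoin.mono ℚ _ _ (by simp)

theorem realQuadField_two_mul_le (d : ℕ) : realQuadField (2 * d) ≤ realBiquadField d := by
  unfold realQuadField
  rw [IntermediateField.adjoin_simple_le_iff]
  have h : √((2 * d : ℕ) : ℝ) = √(2 : ℝ) * √(d : ℝ) := by
    rw [Nat.cast_mul, Nat.cast_ofNat, Real.sqrt_mul (by norm_num)]
  rw [h]
  exact mul_mem (IntermediateField.subset_adjoin ℚ _ (by simp))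
    (IntermediateField.subset_adjoin ℚ _ (by simp))

end

/-! ### Quadratic and biquadratic subfields of the real numbers -/

/-! The argument determines `√ε_D` and `√ε_{2D}` modulo the nonzero elements of `K₁`. Both units
have norm `+1`, since `-1` is not a square modulo `q₁`. For `ε_D = (m + n√D)/2` the identity
`(m+2)(m-2) = D n²` splits into `m+2 = d₁x²`, `m-2 = d₂y²` with `d₁d₂ = D`, so that `√ε_D = (x√d₁ +
y√d₂)/2` and `d₁x² - d₂y² = 4`. Minimality of `ε_D` excludes `d₁ = 1`, and Legendre symbols leave
only `d₁ = q₁q₂`, `d₂ = p` (`eq_of_mul_sq_sub_mul_sq_eq_four`). Hence `√(p ε_D)` lies in `K` and has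
norm `-p`; it generates the prime above `p`.

In the same way `√ε_{2D} = a√d₁ + b√d₂` with `d₁d₂ = 2D` and `d₁a² - d₂b² = 1`; either `d₁ = 2p`, or
`q₁` and `q₂` divide different factors (`eq_or_dvd_of_mul_sq_sub_mul_sq_eq_one`). Up to factors in
`K₁`, the two roots are therefore `√p` and `√d₁`. An integer has its root in `K₁` only if it is `1`,
`2`, `D` or `2D` up to rational squares. So neither root lies in `K₁`, and their product does
exactly when `d₁ = 2p`. Since `r + 1 = 2d₁a²`, this is the criterion that `p(r+1)` is a square.

For the unit group, the norms of a unit `u` of `K₁` to the quadratic subfields give `u² = ε_D^a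
ε_{2D}^b ε_2^c` (`exists_sq_mul_eq_mul`). Here `c` is even because `ε_2` has norm `-1` to `K` while
the norm of `u²` is a square, and `a ≡ b` mod `2` by the preceding paragraph. Thus only `√(ε_D
ε_{2D})` can be missing from the group generated by the three units. -/

theorem natCast_mem_intermediateField (L : IntermediateField ℚ ℝ) (n : ℕ) : (n : ℝ) ∈ L :=
  natCast_mem L n

theorem ratCast_mem_intermediateField (L : IntermediateField ℚ ℝ) (a : ℚ) : (a : ℝ) ∈ L :=
  SubfieldClass.ratCast_mem L a

theorem isAlgebraic_sqrt_natCast (d : ℕ) : IsAlgebraic ℚ √(d : ℝ) := by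
  refine ⟨Polynomial.X ^ 2 - Polynomial.C (d : ℚ), Polynomial.X_pow_sub_C_ne_zero two_pos _, ?_⟩
  simp

theorem sqrt_mem_realQuadField (d : ℕ) : √(d : ℝ) ∈ realQuadField d :=
  IntermediateField.subset_adjoin ℚ _ (by simp)

theorem mem_realQuadField_iff {d : ℕ} {x : ℝ} :
    x ∈ realQuadField d ↔ ∃ a b : ℚ, x = a + b * √(d : ℝ) := by
  constructor
  · intro hx
    rw [← IntermediateField.mem_toSubalgebra, realQuadField,
      IntermediateField.adjoin_simple_toSubalgebra_of_isAlgebraic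
        (isAlgebraic_sqrt_natCast d)] at hx
    induction hx using Algebra.adjoin_induction with
    | mem x hx => exact ⟨0, 1, by simpa using hx⟩
    | algebraMap r => exact ⟨r, 0, by simp⟩
    | add x y _ _ hx hy =>
      obtain ⟨a, b, rfl⟩ := hx
      obtain ⟨a', b', rfl⟩ := hy
      exact ⟨a + a', b + b', by push_cast; ring⟩
    | mul x y _ _ hx hy =>
      obtain ⟨a, b, rfl⟩ := hx
      obtain ⟨a', b', rfl⟩ := hy
      refine ⟨a * a' + b * b' * d, a * b' + b * a', ?_⟩
      have h : √(d : ℝ) ^ 2 = d := Real.sq_sqrt d.cast_nonneg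
      push_cast
      linear_combination (b * b' : ℝ) * h
  · rintro ⟨a, b, rfl⟩
    exact add_mem (ratCast_mem_intermediateField _ a)
      (mul_mem (ratCast_mem_intermediateField _ b) (sqrt_mem_realQuadField d))

theorem sqrt_two_mem_realBiquadField (d : ℕ) : √(2 : ℝ) ∈ realBiquadField d :=
  IntermediateField.subset_adjoin ℚ _ (by simp)

theorem sqrt_mem_realBiquadField (d : ℕ) : √(d : ℝ) ∈ realBiquadField d :=
  IntermediateField.subset_adjoin ℚ _ (by simp)

theorem mem_realBiquadField_iff {d : ℕ} {x : ℝ} :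
    x ∈ realBiquadField d ↔
      ∃ a b c e : ℚ, x = a + b * √2 + c * √(d : ℝ) + e * (√2 * √(d : ℝ)) := by
  have h2 : √(2 : ℝ) ^ 2 = 2 := Real.sq_sqrt zero_le_two
  have hd : √(d : ℝ) ^ 2 = d := Real.sq_sqrt d.cast_nonneg
  constructor
  · intro hx
    rw [← IntermediateField.mem_toSubalgebra, realBiquadField,
      IntermediateField.adjoin_toSubalgebra_of_isAlgebraic] at hx
    · induction hx using Algebra.adjoin_induction with
      | mem x hx =>
        rcases hx with rfl | rfl
        · exact ⟨0, 1, 0, 0, by simp⟩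
        · exact ⟨0, 0, 1, 0, by simp⟩
      | algebraMap r => exact ⟨r, 0, 0, 0, by simp⟩
      | add x y _ _ hx hy =>
        obtain ⟨a, b, c, e, rfl⟩ := hx
        obtain ⟨a', b', c', e', rfl⟩ := hy
        exact ⟨a + a', b + b', c + c', e + e', by push_cast; ring⟩
      | mul x y _ _ hx hy =>
        obtain ⟨a, b, c, e, rfl⟩ := hx
        obtain ⟨a', b', c', e', rfl⟩ := hy
        refine ⟨a * a' + 2 * b * b' + c * c' * d + 2 * e * e' * d,
          a * b' + b * a' + (c * e' + e * c') * d,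
          a * c' + c * a' + 2 * (b * e' + e * b'),
          a * e' + e * a' + b * c' + c * b', ?_⟩
        push_cast
        linear_combination (b * b' + (b * e' + e * b') * √(d : ℝ) + e * e' * √(d : ℝ) ^ 2 : ℝ) * h2
          + (c * c' + (c * e' + e * c') * √2 + 2 * e * e' : ℝ) * hd
    · rintro x (rfl | rfl)
      · exact_mod_cast isAlgebraic_sqrt_natCast 2
      · exact isAlgebraic_sqrt_natCast d
  · rintro ⟨a, b, c, e, rfl⟩
    have s2 := sqrt_two_mem_realBiquadField d
    have sd := sqrt_mem_realBiquadField d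
    have r := ratCast_mem_intermediateField (realBiquadField d)
    exact add_mem (add_mem (add_mem (r a) (mul_mem (r b) s2)) (mul_mem (r c) sd))
      (mul_mem (r e) (mul_mem s2 sd))

/-- If `x` lies in the quadratic extension `F(s)` of `F` and `x ^ 2`, `s ^ 2` lie in `F`, then
`x ∈ F` or `x s ∈ F`. -/
theorem mem_or_mul_mem_of_sq_mem {F : IntermediateField ℚ ℝ} {s x a b : ℝ} (hs : s ∉ F)
    (hs2 : s ^ 2 ∈ F) (hx2 : x ^ 2 ∈ F) (ha : a ∈ F) (hb : b ∈ F) (hx : x = a + b * s) :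
    x ∈ F ∨ x * s ∈ F := by
  by_cases hb0 : b = 0
  · left; rw [hx, hb0, zero_mul, add_zero]; exact ha
  by_cases ha0 : a = 0
  · right
    rw [hx, ha0, zero_add, mul_assoc, ← sq]
    exact mul_mem hb hs2
  exfalso
  apply hs
  have h2 : (2 : ℝ) ∈ F := by exact_mod_cast natCast_mem_intermediateField F 2
  -- Expanding `x²` produces the cross term `2ab s`; with `ab ≠ 0` it can be solved for `s`.
  have h : s = (x ^ 2 - a ^ 2 - b ^ 2 * s ^ 2) / (2 * a * b) := by
    rw [hx]; field_simp; ring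
  rw [h]
  exact div_mem (sub_mem (sub_mem hx2 (pow_mem ha 2)) (mul_mem (pow_mem hb 2) hs2))
    (mul_mem (mul_mem h2 ha) hb)

theorem mem_bot_iff_exists_ratCast {x : ℝ} :
    x ∈ (⊥ : IntermediateField ℚ ℝ) ↔ ∃ a : ℚ, x = a := by
  rw [IntermediateField.mem_bot]
  simp [eq_comm]

theorem sqrt_natCast_mem_bot_iff {n : ℕ} :
    √(n : ℝ) ∈ (⊥ : IntermediateField ℚ ℝ) ↔ IsSquare n := by
  rw [mem_bot_iff_exists_ratCast, ← not_iff_not, ← irrational_sqrt_natCast_iff, Irrational]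
  simp [eq_comm]

theorem sqrt_natCast_sq_mem (F : IntermediateField ℚ ℝ) (n : ℕ) : √(n : ℝ) ^ 2 ∈ F := by
  rw [Real.sq_sqrt n.cast_nonneg]
  exact natCast_mem_intermediateField F n

theorem isSquare_or_of_sqrt_mem_realQuadField {n d : ℕ} (hd : ¬ IsSquare d)
    (h : √(n : ℝ) ∈ realQuadField d) : IsSquare n ∨ IsSquare (n * d) := by
  obtain ⟨a, b, hab⟩ := mem_realQuadField_iff.mp h
  rcases mem_or_mul_mem_of_sq_mem (F := ⊥) (by rwa [sqrt_natCast_mem_bot_iff])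
    (sqrt_natCast_sq_mem _ d) (sqrt_natCast_sq_mem _ n) (ratCast_mem_intermediateField _ a)
    (ratCast_mem_intermediateField _ b) hab with h | h
  · exact .inl (sqrt_natCast_mem_bot_iff.mp h)
  · right
    rw [← Real.sqrt_mul n.cast_nonneg, ← Nat.cast_mul] at h
    exact sqrt_natCast_mem_bot_iff.mp h

theorem exists_realQuadField_add_mul_sqrt_two {d : ℕ} {x : ℝ} (hx : x ∈ realBiquadField d) :
    ∃ a ∈ realQuadField d, ∃ b ∈ realQuadField d, x = a + b * √2 := by
  obtain ⟨a, b, c, e, h⟩ := mem_realBiquadField_iff.mp hx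
  exact ⟨_, mem_realQuadField_iff.mpr ⟨a, c, rfl⟩, _, mem_realQuadField_iff.mpr ⟨b, e, rfl⟩,
    by rw [h]; ring⟩

theorem sqrt_natCast_mul (m n : ℕ) : √((m * n : ℕ) : ℝ) = √(m : ℝ) * √(n : ℝ) := by
  rw [Nat.cast_mul, Real.sqrt_mul m.cast_nonneg]

theorem sqrt_two_natCast_mul (n : ℕ) : √((2 * n : ℕ) : ℝ) = √2 * √(n : ℝ) := by
  rw [sqrt_natCast_mul, Nat.cast_ofNat]

theorem exists_realQuadField_two_mul_add_mul_sqrt_two {d : ℕ} {x : ℝ}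
    (hx : x ∈ realBiquadField d) :
    ∃ a ∈ realQuadField (2 * d), ∃ b ∈ realQuadField (2 * d), x = a + b * √2 := by
  obtain ⟨a, b, c, e, h⟩ := mem_realBiquadField_iff.mp hx
  -- Over `ℚ(√(2d))` one has `√d = (√(2d) / 2) · √2`, which explains the coefficient `c / 2`.
  refine ⟨_, mem_realQuadField_iff.mpr ⟨a, e, rfl⟩, _,
    mem_realQuadField_iff.mpr ⟨b, c / 2, rfl⟩, ?_⟩
  have h2 : √(2 : ℝ) ^ 2 = 2 := Real.sq_sqrt zero_le_two
  rw [h, sqrt_two_natCast_mul]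
  push_cast
  linear_combination (-(c / 2 * √(d : ℝ)) : ℝ) * h2

theorem exists_realQuadField_two_add_mul_sqrt {d : ℕ} {x : ℝ} (hx : x ∈ realBiquadField d) :
    ∃ a ∈ realQuadField 2, ∃ b ∈ realQuadField 2, x = a + b * √(d : ℝ) := by
  obtain ⟨a, b, c, e, h⟩ := mem_realBiquadField_iff.mp hx
  refine ⟨_, mem_realQuadField_iff.mpr ⟨a, b, rfl⟩, _,
    mem_realQuadField_iff.mpr ⟨c, e, rfl⟩, ?_⟩
  rw [h]
  push_cast
  ring

/-- Kummer theory for exponent two, by descending the tower `ℚ ⊂ ℚ(√d) ⊂ ℚ(√2, √d)` with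
`mem_or_mul_mem_of_sq_mem` at each step. -/
theorem isSquare_or_of_sqrt_mem_realBiquadField {n d : ℕ} (hd : ¬ IsSquare d)
    (h2d : ¬ IsSquare (2 * d)) (h : √(n : ℝ) ∈ realBiquadField d) :
    IsSquare n ∨ IsSquare (n * d) ∨ IsSquare (n * 2) ∨ IsSquare (n * (2 * d)) := by
  obtain ⟨a, ha, b, hb, hab⟩ := exists_realQuadField_add_mul_sqrt_two h
  have h2 : √((2 : ℕ) : ℝ) ∉ realQuadField d := by
    intro h2
    rcases isSquare_or_of_sqrt_mem_realQuadField hd h2 with h2 | h2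
    · exact Nat.prime_two.prime.not_isSquare h2
    · exact h2d h2
  rcases mem_or_mul_mem_of_sq_mem (s := √((2 : ℕ) : ℝ)) h2 (sqrt_natCast_sq_mem _ 2)
    (sqrt_natCast_sq_mem _ n) ha hb (by exact_mod_cast hab) with h | h
  · rcases isSquare_or_of_sqrt_mem_realQuadField hd h with h | h <;> simp [h]
  · rw [← sqrt_natCast_mul] at h
    rcases isSquare_or_of_sqrt_mem_realQuadField hd h with h | h
    · simp [h]
    · rw [mul_assoc] at h; simp [h]

/-! ### Norms in quadratic extensions -/

theorem linearIndependent_one_sqrt {F L : Type*} [Field F] [Field L] [Algebra F L] {s : L}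
    (hs : ∀ a : F, algebraMap F L a ≠ s) : LinearIndependent F ![1, s] := by
  rw [LinearIndependent.pair_iff]
  intro a b h
  have hb : b = 0 := by
    by_contra hb
    apply hs (-a / b)
    have hb' : algebraMap F L b ≠ 0 := by simpa using hb
    rw [Algebra.smul_def, Algebra.smul_def] at h
    rw [map_div₀, map_neg]
    field_simp
    linear_combination -h
  subst hb
  simpa using h

/-- All three claims are read off the basis `1, s`, in which multiplication by `a + b s` has matrix
`!![a, b * c; b, a]`. -/
theorem norm_trace_add_mul_sqrt {F L : Type*} [Field F] [Field L] [Algebra F L] {s : L} {c : F}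
    (hs : ∀ a : F, algebraMap F L a ≠ s) (hc : s ^ 2 = algebraMap F L c)
    (hspan : ∀ x : L, ∃ a b : F, x = algebraMap F L a + algebraMap F L b * s) (a b : F) :
    Module.Finite F L ∧
    Algebra.norm F (algebraMap F L a + algebraMap F L b * s) = a ^ 2 - b ^ 2 * c ∧
    Algebra.trace F L (algebraMap F L a + algebraMap F L b * s) = 2 * a := by
  have hli := linearIndependent_one_sqrt hs
  have hsp : ⊤ ≤ Submodule.span F (Set.range ![1, s]) := by
    intro x _
    obtain ⟨a, b, rfl⟩ := hspan x
    rw [Matrix.range_cons, Matrix.range_cons, Matrix.range_empty, Set.union_empty,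
      Set.singleton_union, Submodule.mem_span_pair]
    exact ⟨a, b, by simp [Algebra.smul_def]⟩
  let B := Module.Basis.mk hli hsp
  have hB0 : B 0 = 1 := by simp [B]
  have hB1 : B 1 = s := by simp [B]
  have hrepr (u v : F) : B.repr (algebraMap F L u + algebraMap F L v * s)
      = Finsupp.single 0 u + Finsupp.single 1 v := by
    rw [show algebraMap F L u + algebraMap F L v * s = u • B 0 + v • B 1 by
      simp [hB0, hB1, Algebra.smul_def]]
    simp
  have hM : Algebra.leftMulMatrix B (algebraMap F L a + algebraMap F L b * s)
      = !![a, b * c; b, a] := by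
    have h0 : (algebraMap F L a + algebraMap F L b * s) * B 0
        = algebraMap F L a + algebraMap F L b * s := by rw [hB0, mul_one]
    have h1 : (algebraMap F L a + algebraMap F L b * s) * B 1
        = algebraMap F L (b * c) + algebraMap F L a * s := by
      rw [hB1, map_mul]
      linear_combination algebraMap F L b * hc
    ext i j
    fin_cases i <;> fin_cases j <;>
      simp only [Fin.zero_eta, Fin.mk_one, Algebra.leftMulMatrix_eq_repr_mul, h0, h1, hrepr] <;>
      simp
  refine ⟨Module.Finite.of_basis B, ?_, ?_⟩
  · rw [Algebra.norm_eq_matrix_det B, hM, Matrix.det_fin_two_of]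
    ring
  · rw [Algebra.trace_eq_matrix_trace B, hM, Matrix.trace_fin_two_of]
    ring

theorem relNorm_add_mul_sqrt {F L : IntermediateField ℚ ℝ} (h : F ≤ L) {s : ℝ} (hsL : s ∈ L)
    (hs : s ∉ F) (hs2 : s ^ 2 ∈ F)
    (hspan : ∀ x ∈ L, ∃ a ∈ F, ∃ b ∈ F, x = a + b * s) {x a b : ℝ} (hx : x ∈ L) (ha : a ∈ F)
    (hb : b ∈ F) (hxab : x = a + b * s) :
    (relNorm h ⟨x, hx⟩ : ℝ) = a ^ 2 - b ^ 2 * s ^ 2 := by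
  let _ : Algebra F L := (IntermediateField.inclusion h).toRingHom.toAlgebra
  have hmap (y : F) : ((algebraMap F L y : L) : ℝ) = y := rfl
  have key := (norm_trace_add_mul_sqrt (F := F) (L := L) (s := ⟨s, hsL⟩) (c := ⟨s ^ 2, hs2⟩)
    (fun a ha ↦ hs (by
      have := congrArg (Subtype.val) ha
      rw [hmap] at this
      rw [← show (a : ℝ) = s from this]; exact a.2))
    (Subtype.ext rfl)
    (fun x ↦ by
      obtain ⟨a, ha, b, hb, hx⟩ := hspan x x.2
      exact ⟨⟨a, ha⟩, ⟨b, hb⟩, Subtype.ext hx⟩) ⟨a, ha⟩ ⟨b, hb⟩).2.1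
  have hx' : (⟨x, hx⟩ : L) = algebraMap F L ⟨a, ha⟩ + algebraMap F L ⟨b, hb⟩ * ⟨s, hsL⟩ :=
    Subtype.ext hxab
  rw [hx']
  exact congrArg Subtype.val key

/-! ### Units of real fields -/

/-- Integrality does not depend on the ambient field, so units can be handled as real numbers. -/
theorem mem_unitSet_iff {L : IntermediateField ℚ ℝ} {x : ℝ} :
    x ∈ unitSet L ↔ x ∈ L ∧ x ≠ 0 ∧ IsIntegral ℤ x ∧ IsIntegral ℤ x⁻¹ := by
  have hint (y : L) : IsIntegral ℤ y ↔ IsIntegral ℤ (y : ℝ) :=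
    (isIntegral_algHom_iff (L.val.restrictScalars ℤ) Subtype.val_injective).symm
  constructor
  · rintro ⟨u, rfl⟩
    have h1 : (((u : 𝓞 L) : L) : ℝ) * (((u⁻¹ : (𝓞 L)ˣ) : 𝓞 L) : L) = 1 := by
      exact_mod_cast congrArg (fun z : 𝓞 L ↦ ((z : L) : ℝ)) u.mul_inv
    refine ⟨((u : 𝓞 L) : L).2, left_ne_zero_of_mul_eq_one h1, (hint _).mp (u : 𝓞 L).2, ?_⟩
    rw [inv_eq_of_mul_eq_one_right h1]
    exact (hint _).mp ((u⁻¹ : (𝓞 L)ˣ) : 𝓞 L).2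
  · rintro ⟨hL, h0, hi, hi'⟩
    refine ⟨⟨⟨⟨x, hL⟩, (hint _).mpr hi⟩, ⟨⟨x⁻¹, inv_mem hL⟩, (hint _).mpr hi'⟩, ?_, ?_⟩, rfl⟩
    · exact RingOfIntegers.ext (Subtype.ext (mul_inv_cancel₀ h0))
    · exact RingOfIntegers.ext (Subtype.ext (inv_mul_cancel₀ h0))

theorem mem_of_mem_unitSet {L : IntermediateField ℚ ℝ} {x : ℝ} (hx : x ∈ unitSet L) : x ∈ L :=
  (mem_unitSet_iff.mp hx).1

theorem one_mem_unitSet (L : IntermediateField ℚ ℝ) : (1 : ℝ) ∈ unitSet L := ⟨1, rfl⟩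

theorem neg_mem_unitSet {L : IntermediateField ℚ ℝ} {x : ℝ} (hx : x ∈ unitSet L) :
    -x ∈ unitSet L := by
  obtain ⟨u, rfl⟩ := hx
  exact ⟨-u, rfl⟩

theorem mul_mem_unitSet {L : IntermediateField ℚ ℝ} {x y : ℝ} (hx : x ∈ unitSet L)
    (hy : y ∈ unitSet L) : x * y ∈ unitSet L := by
  obtain ⟨u, rfl⟩ := hx
  obtain ⟨v, rfl⟩ := hy
  exact ⟨u * v, rfl⟩

theorem inv_mem_unitSet {L : IntermediateField ℚ ℝ} {x : ℝ} (hx : x ∈ unitSet L) :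
    x⁻¹ ∈ unitSet L := by
  rw [mem_unitSet_iff] at hx ⊢
  exact ⟨inv_mem hx.1, inv_ne_zero hx.2.1, hx.2.2.2, by rw [inv_inv]; exact hx.2.2.1⟩

theorem zpow_mem_unitSet {L : IntermediateField ℚ ℝ} {x : ℝ} (hx : x ∈ unitSet L) (k : ℤ) :
    x ^ k ∈ unitSet L := by
  have hpow (n : ℕ) : x ^ n ∈ unitSet L := by
    induction n with
    | zero => simpa using one_mem_unitSet L
    | succ n ih => rw [pow_succ]; exact mul_mem_unitSet ih hx
  cases k with
  | ofNat n => simpa using hpow n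
  | negSucc n => rw [zpow_negSucc]; exact inv_mem_unitSet (hpow _)

theorem unitSet_mono {F L : IntermediateField ℚ ℝ} (h : F ≤ L) {x : ℝ} (hx : x ∈ unitSet F) :
    x ∈ unitSet L := by
  rw [mem_unitSet_iff] at hx ⊢
  exact ⟨h hx.1, hx.2⟩

theorem mem_unitSet_of_sq_mem {L : IntermediateField ℚ ℝ} {x : ℝ} (hx : x ∈ L)
    (h : x ^ 2 ∈ unitSet L) : x ∈ unitSet L := by
  rw [mem_unitSet_iff] at h ⊢
  obtain ⟨-, h0, hi, hi'⟩ := h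
  exact ⟨hx, fun h ↦ h0 (by rw [h]; norm_num), .of_pow two_pos hi,
    .of_pow two_pos (by rwa [inv_pow])⟩

theorem exists_intCast_eq_of_isIntegral {a : ℚ} (ha : IsIntegral ℤ a) : ∃ m : ℤ, a = m := by
  obtain ⟨m, hm⟩ := IsIntegrallyClosed.isIntegral_iff.mp ha
  exact ⟨m, by simp [← hm]⟩

theorem norm_trace_realQuadField {d : ℕ} (hd : ¬ IsSquare d) {x : realQuadField d} {a b : ℚ}
    (hx : (x : ℝ) = a + b * √(d : ℝ)) :
    Module.Finite ℚ (realQuadField d) ∧ Algebra.norm ℚ x = a ^ 2 - b ^ 2 * d ∧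
      Algebra.trace ℚ (realQuadField d) x = 2 * a := by
  set s : realQuadField d := ⟨√(d : ℝ), sqrt_mem_realQuadField d⟩ with hs
  have hx' : x = algebraMap ℚ _ a + algebraMap ℚ _ b * s := Subtype.ext hx
  rw [hx']
  exact norm_trace_add_mul_sqrt
    (fun a ha ↦ hd (sqrt_natCast_mem_bot_iff.mp
      (mem_bot_iff_exists_ratCast.mpr ⟨a, (congrArg Subtype.val ha).symm⟩)))
    (Subtype.ext (by simp [hs]))
    (fun x ↦ by
      obtain ⟨a, b, hx⟩ := mem_realQuadField_iff.mp x.2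
      exact ⟨a, b, Subtype.ext hx⟩) a b

theorem exists_intCast_of_isIntegral_add_mul_sqrt {d : ℕ} (hd : ¬ IsSquare d) {a b : ℚ}
    (h : IsIntegral ℤ (a + b * √(d : ℝ) : ℝ)) :
    ∃ m k : ℤ, 2 * a = m ∧ a ^ 2 - b ^ 2 * d = k := by
  set x : realQuadField d :=
    ⟨a + b * √(d : ℝ), mem_realQuadField_iff.mpr ⟨a, b, rfl⟩⟩ with hxdef
  have hx : IsIntegral ℤ x :=
    (isIntegral_algHom_iff ((realQuadField d).val.restrictScalars ℤ) Subtype.val_injective).mp h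
  obtain ⟨hfin, hn, ht⟩ := norm_trace_realQuadField hd (x := x) (a := a) (b := b) rfl
  obtain ⟨m, hm⟩ := exists_intCast_eq_of_isIntegral (Algebra.isIntegral_trace (L := ℚ) hx)
  obtain ⟨k, hk⟩ := exists_intCast_eq_of_isIntegral (Algebra.isIntegral_norm ℚ hx)
  exact ⟨m, k, by rw [← ht, hm], by rw [← hn, hk]⟩

/-- The square of the denominator of `q` is coprime to the numerator and so divides `d`. -/
theorem exists_intCast_of_squarefree_mul_sq {d : ℕ} (hd : Squarefree d) {q : ℚ} {k : ℤ}
    (h : d * q ^ 2 = k) : ∃ n : ℤ, q = n := by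
  have hden : (q.den : ℚ) ≠ 0 := by exact_mod_cast q.den_nz
  have h1 : (d : ℤ) * q.num ^ 2 = k * q.den ^ 2 := by
    have : (d : ℚ) * q.num ^ 2 = k * q.den ^ 2 := by
      rw [← h]
      nth_rewrite 2 [← q.num_div_den]
      field_simp
    exact_mod_cast this
  have h2 : (q.den : ℤ) ^ 2 ∣ d := by
    have hcop : IsCoprime ((q.den : ℤ) ^ 2) (q.num ^ 2) := by
      apply IsCoprime.pow
      rw [Int.isCoprime_iff_gcd_eq_one, Int.gcd_comm]
      simpa [Int.gcd] using q.reduced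
    exact hcop.dvd_of_dvd_mul_right ⟨k, by rw [h1]; ring⟩
  have h3 : q.den * q.den ∣ d := by rw [← sq]; exact_mod_cast h2
  have h4 : q.den = 1 := Nat.isUnit_iff.mp (hd _ h3)
  exact ⟨q.num, (Rat.coe_int_num_of_den_eq_one h4).symm⟩

theorem exists_eq_half_of_isIntegral {d : ℕ} (hd : Squarefree d) (hd1 : ¬ IsSquare d) {x : ℝ}
    (hx : x ∈ realQuadField d) (hi : IsIntegral ℤ x) :
    ∃ m n k : ℤ, x = (m + n * √(d : ℝ)) / 2 ∧ m ^ 2 - d * n ^ 2 = 4 * k := by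
  obtain ⟨a, b, rfl⟩ := mem_realQuadField_iff.mp hx
  obtain ⟨m, k, hm, hk⟩ := exists_intCast_of_isIntegral_add_mul_sqrt hd1 hi
  -- Trace and norm give `d (2b)² = (2a)² - 4k`, an integer.
  obtain ⟨n, hn⟩ := exists_intCast_of_squarefree_mul_sq hd (q := 2 * b) (k := m ^ 2 - 4 * k) (by
    push_cast
    rw [← hm, ← hk]
    ring)
  refine ⟨m, n, k, ?_, ?_⟩
  · have hm' : (2 * a : ℝ) = m := by exact_mod_cast hm
    have hn' : (2 * b : ℝ) = n := by exact_mod_cast hn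
    rw [← hm', ← hn']
    ring
  · have : (m : ℚ) ^ 2 - d * n ^ 2 = 4 * k := by
      rw [← hm, ← hn, ← hk]
      ring
    exact_mod_cast this

theorem isIntegral_half_add_mul_sqrt {d : ℕ} {m n k : ℤ} (h : m ^ 2 - d * n ^ 2 = 4 * k) :
    IsIntegral ℤ ((m + n * √(d : ℝ)) / 2 : ℝ) := by
  refine ⟨Polynomial.X ^ 2 + (Polynomial.C (-m) * Polynomial.X + Polynomial.C k),
    Polynomial.monic_X_pow_add (lt_of_le_of_lt Polynomial.degree_linear_le (by norm_num)), ?_⟩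
  have hd : √(d : ℝ) ^ 2 = d := Real.sq_sqrt d.cast_nonneg
  have h' : (m : ℝ) ^ 2 - d * n ^ 2 = 4 * k := by exact_mod_cast h
  simp only [Polynomial.eval₂_add, Polynomial.eval₂_mul, Polynomial.eval₂_pow,
    Polynomial.eval₂_X, Polynomial.eval₂_C]
  simp only [eq_intCast, Int.cast_neg]
  linear_combination (n ^ 2 / 4 : ℝ) * hd - h' / 4

theorem half_add_mul_sqrt_mem (d : ℕ) (m n : ℤ) :
    ((m + n * √(d : ℝ)) / 2 : ℝ) ∈ realQuadField d :=
  mem_realQuadField_iff.mpr ⟨m / 2, n / 2, by push_cast; ring⟩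

theorem half_add_mul_sqrt_mem_unitSet {d : ℕ} {m n e : ℤ} (he : e = 1 ∨ e = -1)
    (h : m ^ 2 - d * n ^ 2 = 4 * e) :
    ((m + n * √(d : ℝ)) / 2 : ℝ) ∈ unitSet (realQuadField d) := by
  have hd : √(d : ℝ) ^ 2 = d := Real.sq_sqrt d.cast_nonneg
  have h' : (m : ℝ) ^ 2 - d * n ^ 2 = 4 * e := by exact_mod_cast h
  have he2 : (e : ℝ) * e = 1 := by rcases he with rfl | rfl <;> norm_num
  -- The inverse is `e` times the conjugate. Its norm is used below in the form `e ^ 2 * e`, so that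
  -- its norm equation is just `e ^ 2` times `h`.
  have hmul : ((m + n * √(d : ℝ)) / 2 : ℝ)
      * (((e * m : ℤ) + (-(e * n) : ℤ) * √(d : ℝ)) / 2) = 1 := by
    push_cast
    linear_combination (-(e * n ^ 2) / 4 : ℝ) * hd + (e / 4 : ℝ) * h' + he2
  rw [mem_unitSet_iff, inv_eq_of_mul_eq_one_right hmul]
  refine ⟨half_add_mul_sqrt_mem d m n, left_ne_zero_of_mul_eq_one hmul,
    isIntegral_half_add_mul_sqrt h, isIntegral_half_add_mul_sqrt (k := e ^ 2 * e) ?_⟩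
  linear_combination e ^ 2 * h

theorem add_mul_sqrt_eq_zero_iff {d : ℕ} (hd : ¬ IsSquare d) {a b : ℚ} :
    (a + b * √(d : ℝ) : ℝ) = 0 ↔ a = 0 ∧ b = 0 := by
  constructor
  · intro h
    have hb : b = 0 := by
      by_contra hb
      have hb' : (b : ℝ) ≠ 0 := by exact_mod_cast hb
      refine hd (sqrt_natCast_mem_bot_iff.mp (mem_bot_iff_exists_ratCast.mpr ⟨-a / b, ?_⟩))
      push_cast
      field_simp
      linear_combination h
    subst hb
    exact ⟨by simpa using h, rfl⟩
  · rintro ⟨rfl, rfl⟩; simp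

/-- The units of `ℚ(√d)` are the numbers `(m + n √d) / 2` with `m ^ 2 - d n ^ 2 = ± 4`. -/
theorem exists_eq_half_of_mem_unitSet {d : ℕ} (hd : Squarefree d) (hd1 : ¬ IsSquare d) {x : ℝ}
    (hx : x ∈ unitSet (realQuadField d)) :
    ∃ m n e : ℤ, (e = 1 ∨ e = -1) ∧ x = (m + n * √(d : ℝ)) / 2 ∧
      m ^ 2 - d * n ^ 2 = 4 * e := by
  obtain ⟨hK, h0, hi, hi'⟩ := mem_unitSet_iff.mp hx
  obtain ⟨m, n, k, hxe, hk⟩ := exists_eq_half_of_isIntegral hd hd1 hK hi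
  obtain ⟨m', n', k', hxe', hk'⟩ := exists_eq_half_of_isIntegral hd hd1 (inv_mem hK) hi'
  refine ⟨m, n, k, ?_, hxe, hk⟩
  have hsq : √(d : ℝ) ^ 2 = d := Real.sq_sqrt d.cast_nonneg
  have h1 : ((m + n * √(d : ℝ)) / 2) * ((m' + n' * √(d : ℝ)) / 2) = 1 := by
    rw [← hxe, ← hxe', mul_inv_cancel₀ h0]
  have h2 := (add_mul_sqrt_eq_zero_iff hd1 (a := m * m' + n * n' * d - 4)
    (b := m * n' + n * m')).mp (by
      push_cast
      linear_combination 4 * h1 - (n * n' : ℝ) * hsq)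
  have h3 : m * m' + n * n' * d - 4 = 0 := by exact_mod_cast h2.1
  have h4 : m * n' + n * m' = 0 := by exact_mod_cast h2.2
  -- Multiplicativity of the norm form: `(m² - dn²)(m'² - dn'²) = (mm' + dnn')² - d(mn' + nm')²`.
  have h5 : 16 * (k * k') = 16 * 1 := by
    linear_combination (-k') * 4 * hk - (m ^ 2 - d * n ^ 2) * hk' +
      (m * m' + n * n' * d + 4) * h3 - (m * n' + n * m') * d * h4
  have h6 : k * k' = 1 := by linarith
  exact Int.isUnit_iff.mp (IsUnit.of_mul_eq_one _ h6)

/-- The conjugate `y` of `x > 1` satisfies `|y| < 1` because `xy = ±1`; hence `m = x + y` and `n√d =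
x - y` are positive. -/
theorem pos_of_one_lt_half_add_mul_sqrt {d : ℕ} (hd : d ≠ 0) {m n e : ℤ} (he : e = 1 ∨ e = -1)
    (h : m ^ 2 - d * n ^ 2 = 4 * e) (h1 : 1 < (m + n * √(d : ℝ)) / 2) : 0 < m ∧ 0 < n := by
  have hsq : √(d : ℝ) ^ 2 = d := Real.sq_sqrt d.cast_nonneg
  have hs : 0 < √(d : ℝ) := Real.sqrt_pos.mpr (by positivity)
  have h' : (m : ℝ) ^ 2 - d * n ^ 2 = 4 * e := by exact_mod_cast h
  set x := (m + n * √(d : ℝ)) / 2 with hx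
  set y := (m - n * √(d : ℝ)) / 2 with hy
  have hxy : x * y = e := by
    rw [hx, hy]
    linear_combination h' / 4 - (n ^ 2 / 4 : ℝ) * hsq
  have habs : |y| < 1 := by
    have : |x| * |y| = 1 := by
      rw [← abs_mul, hxy]
      rcases he with rfl | rfl <;> simp
    rw [abs_of_pos (by linarith)] at this
    nlinarith [abs_nonneg y]
  rw [abs_lt] at habs
  have hm : (0 : ℝ) < m := by
    have : (m : ℝ) = x + y := by rw [hx, hy]; ring
    linarith
  have hn : (0 : ℝ) < n * √(d : ℝ) := by
    have : n * √(d : ℝ) = x - y := by rw [hx, hy]; ring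
    linarith
  exact ⟨by exact_mod_cast hm, by exact_mod_cast pos_of_mul_pos_left hn hs.le⟩

theorem exists_one_lt_mem_unitSet {d : ℕ} (hd1 : ¬ IsSquare d) :
    ∃ x ∈ unitSet (realQuadField d), 1 < x := by
  have hd0 : 0 < d := Nat.pos_of_ne_zero fun h ↦ hd1 ⟨0, by simp [h]⟩
  obtain ⟨x, y, h, hy⟩ := Pell.exists_of_not_isSquare (d := d) (by exact_mod_cast hd0)
    (by rwa [Int.isSquare_natCast_iff])
  have h' : (2 * |x|) ^ 2 - d * (2 * |y|) ^ 2 = 4 * 1 := by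
    rw [mul_pow, mul_pow, sq_abs, sq_abs]
    linear_combination 4 * h
  refine ⟨_, half_add_mul_sqrt_mem_unitSet (.inl rfl) h', ?_⟩
  have hy1 : (1 : ℝ) ≤ |y| := by exact_mod_cast Int.one_le_abs hy
  have hx1 : (1 : ℝ) ≤ |x| := by
    have : x ≠ 0 := by
      rintro rfl
      nlinarith [mul_nonneg (Int.natCast_nonneg d) (sq_nonneg y)]
    exact_mod_cast Int.one_le_abs this
  have hs : 0 < √(d : ℝ) := Real.sqrt_pos.mpr (by exact_mod_cast hd0)
  have hys := mul_pos (lt_of_lt_of_le one_pos hy1) hs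
  push_cast at hx1 hys ⊢
  linarith

/-- Units in `(1, x₀]` have positive coefficients bounded by `2x₀`, so there are finitely many and
the infimum is attained. -/
theorem isLeast_fundamentalUnit {d : ℕ} (hd : Squarefree d) (hd1 : ¬ IsSquare d) :
    IsLeast {x | x ∈ unitSet (realQuadField d) ∧ 1 < x} (fundamentalUnit d) := by
  obtain ⟨x₀, hx₀, h1x₀⟩ := exists_one_lt_mem_unitSet hd1
  have hd0 : d ≠ 0 := hd.ne_zero
  have hs : 1 ≤ √(d : ℝ) := by
    rw [Real.one_le_sqrt]
    exact_mod_cast Nat.one_le_iff_ne_zero.mpr hd0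
  set S := {x | x ∈ unitSet (realQuadField d) ∧ 1 < x} with hS
  have hfin : (S ∩ Set.Iic x₀).Finite := by
    apply ((Set.finite_Icc (0 : ℤ) ⌈2 * x₀⌉).prod (Set.finite_Icc (0 : ℤ) ⌈2 * x₀⌉)).image
      (fun z : ℤ × ℤ ↦ ((z.1 + z.2 * √(d : ℝ)) / 2 : ℝ)) |>.subset
    rintro x ⟨⟨hx, h1x⟩, hxle⟩
    obtain ⟨m, n, e, he, rfl, h⟩ := exists_eq_half_of_mem_unitSet hd hd1 hx
    obtain ⟨hm, hn⟩ := pos_of_one_lt_half_add_mul_sqrt hd0 he h h1x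
    have hm' : (0 : ℝ) < m := by exact_mod_cast hm
    have hn' : (0 : ℝ) < n := by exact_mod_cast hn
    rw [Set.mem_Iic] at hxle
    refine ⟨(m, n), ⟨⟨hm.le, ?_⟩, ⟨hn.le, ?_⟩⟩, rfl⟩
    · refine Int.cast_le.mp (le_trans ?_ (Int.le_ceil _))
      nlinarith
    · refine Int.cast_le.mp (le_trans ?_ (Int.le_ceil _))
      nlinarith
  obtain ⟨y, ⟨hyS, hyle⟩, hmin⟩ := Set.exists_min_image _ id hfin
    ⟨x₀, ⟨hx₀, h1x₀⟩, Set.self_mem_Iic⟩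
  have hleast : IsLeast S y := by
    refine ⟨hyS, fun z hz ↦ ?_⟩
    rcases le_total z x₀ with h | h
    · exact hmin z ⟨hz, h⟩
    · exact le_trans hyle h
  rw [fundamentalUnit, ← hS, hleast.csInf_eq]
  exact hleast

/-- Choose `k` with `ε^k ≤ x < ε^(k+1)`; the unit `x / ε^k` lies in `[1, ε)` and must be `1`. -/
theorem exists_zpow_of_pos_mem_unitSet {d : ℕ} (hd : Squarefree d) (hd1 : ¬ IsSquare d) {x : ℝ}
    (hx : x ∈ unitSet (realQuadField d)) (h0 : 0 < x) : ∃ k : ℤ, x = fundamentalUnit d ^ k := by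
  obtain ⟨⟨hε, h1ε⟩, hle⟩ := isLeast_fundamentalUnit hd hd1
  obtain ⟨k, hk1, hk2⟩ := exists_mem_Ico_zpow h0 h1ε
  set ε := fundamentalUnit d
  have hε0 : 0 < ε := by linarith
  have hpos : 0 < ε ^ k := zpow_pos hε0 k
  refine ⟨k, (hk1.antisymm (not_lt.mp fun hlt ↦ ?_)).symm⟩
  have h2 : ε ≤ x * (ε ^ k)⁻¹ :=
    hle ⟨mul_mem_unitSet hx (inv_mem_unitSet (zpow_mem_unitSet hε k)), by
      rwa [← div_eq_mul_inv, one_lt_div hpos]⟩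
  rw [← div_eq_mul_inv, le_div_iff₀ hpos, ← zpow_one_add₀ hε0.ne', add_comm] at h2
  linarith

theorem exists_zpow_of_mem_unitSet {d : ℕ} (hd : Squarefree d) (hd1 : ¬ IsSquare d) {x : ℝ}
    (hx : x ∈ unitSet (realQuadField d)) : ∃ k : ℤ, |x| = fundamentalUnit d ^ k := by
  have h0 : x ≠ 0 := (mem_unitSet_iff.mp hx).2.1
  refine exists_zpow_of_pos_mem_unitSet hd hd1 ?_ (abs_pos.mpr h0)
  rcases abs_choice x with h | h <;> rw [h]
  exacts [hx, neg_mem_unitSet hx]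

theorem fundamentalUnit_two : fundamentalUnit 2 = 1 + √2 := by
  have h2 : ¬ IsSquare 2 := Nat.prime_two.prime.not_isSquare
  obtain ⟨⟨hε, h1ε⟩, hle⟩ := isLeast_fundamentalUnit Nat.prime_two.prime.squarefree h2
  have hs : 0 < √(2 : ℝ) := by positivity
  apply le_antisymm
  · refine hle ⟨?_, by linarith⟩
    have := half_add_mul_sqrt_mem_unitSet (d := 2) (m := 2) (n := 2) (e := -1) (.inr rfl)
      (by norm_num)
    convert this using 1
    push_cast
    ring
  · obtain ⟨m, n, e, he, hx, h⟩ :=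
      exists_eq_half_of_mem_unitSet Nat.prime_two.prime.squarefree h2 hε
    obtain ⟨hm, hn⟩ := pos_of_one_lt_half_add_mul_sqrt two_ne_zero he h (hx ▸ h1ε)
    push_cast at h hx
    have hm2 : Even m := by
      have : Even (m ^ 2) := ⟨2 * e + n ^ 2, by linarith⟩
      exact (Int.even_pow.mp this).1
    obtain ⟨r, rfl⟩ := hm2
    have hn2 : Even n := by
      have : Even (n ^ 2) := ⟨r ^ 2 - e, by linarith⟩
      exact (Int.even_pow.mp this).1
    obtain ⟨t, rfl⟩ := hn2
    have hr : (1 : ℝ) ≤ r := by exact_mod_cast (by lia : (1 : ℤ) ≤ r)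
    have ht : (1 : ℝ) ≤ t := by exact_mod_cast (by lia : (1 : ℤ) ≤ t)
    rw [hx]
    push_cast
    nlinarith

/-! ### Arithmetic of the fundamental units -/

theorem Squarefree.not_isSquare_of_ne_one {d : ℕ} (hd : Squarefree d) (h1 : d ≠ 1) :
    ¬ IsSquare d := by
  rintro ⟨k, rfl⟩
  have := Nat.isUnit_iff.mp (hd k dvd_rfl)
  simp [this] at h1

/-- Uniqueness of the squarefree part: once the gcd of `s` and `t` is removed, their squares divide
`N` and `M` respectively. -/
theorem Squarefree.eq_of_mul_sq_eq {M N s t : ℕ} (hM : Squarefree M) (hN : Squarefree N)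
    (hs : s ≠ 0) (h : M * s ^ 2 = N * t ^ 2) : M = N ∧ s = t := by
  have hg : 0 < s.gcd t := Nat.gcd_pos_of_pos_left _ (Nat.pos_of_ne_zero hs)
  obtain ⟨s', t', hcop, hs', ht'⟩ := Nat.exists_coprime s t
  generalize s.gcd t = g at *
  subst hs' ht'
  have h' : M * s' ^ 2 = N * t' ^ 2 := by
    have hg2 : 0 < g ^ 2 := by positivity
    exact Nat.eq_of_mul_eq_mul_left hg2 (by linarith)
  have hs1 : s' = 1 := by
    refine Nat.isUnit_iff.mp (hN s' ?_)
    rw [← sq]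
    exact (Nat.Coprime.pow 2 2 hcop).dvd_of_dvd_mul_right ⟨M, by rw [← h']; ring⟩
  have ht1 : t' = 1 := by
    refine Nat.isUnit_iff.mp (hM t' ?_)
    rw [← sq]
    exact (Nat.Coprime.pow 2 2 hcop.symm).dvd_of_dvd_mul_right ⟨N, by rw [h']; ring⟩
  subst hs1 ht1
  exact ⟨by simpa using h', rfl⟩

/-- If the product of two coprime numbers is squarefree up to a square factor, then both factors
are accordingly squarefree up to a square factor. -/
theorem Nat.Coprime.exists_eq_mul_sq {a b N t : ℕ} (hab : a.Coprime b) (h : a * b = N * t ^ 2)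
    (hN : Squarefree N) (ht : t ≠ 0) :
    ∃ d₁ d₂ x y : ℕ, d₁ * d₂ = N ∧ a = d₁ * x ^ 2 ∧ b = d₂ * y ^ 2 ∧ t = x * y := by
  obtain ⟨d₁, x, rfl, h1⟩ := Nat.sq_mul_squarefree a
  obtain ⟨d₂, y, rfl, h2⟩ := Nat.sq_mul_squarefree b
  have hcop : d₁.Coprime d₂ :=
    Nat.Coprime.of_dvd (Dvd.intro_left _ rfl) (Dvd.intro_left _ rfl) hab
  have hsq : Squarefree (d₁ * d₂) := (Nat.squarefree_mul hcop).mpr ⟨h1, h2⟩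
  have hxy : x * y ≠ 0 := by
    intro h0
    have : x ^ 2 * d₁ * (y ^ 2 * d₂) = (x * y) ^ 2 * (d₁ * d₂) := by ring
    rw [this, h0] at h
    have : N * t ^ 2 ≠ 0 := mul_ne_zero hN.ne_zero (pow_ne_zero 2 ht)
    rw [zero_pow two_ne_zero, zero_mul] at h
    exact this h.symm
  obtain ⟨hN', ht'⟩ := hsq.eq_of_mul_sq_eq hN hxy (t := t) (by rw [← h]; ring)
  exact ⟨d₁, d₂, x, y, hN', by ring, by ring, ht'.symm⟩

theorem Nat.Prime.mul_eq_mul_cases {p a b N : ℕ} (hp : p.Prime) (h : a * b = p * N) :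
    (∃ c, a = p * c ∧ c * b = N) ∨ ∃ c, b = p * c ∧ a * c = N := by
  rcases (Nat.Prime.dvd_mul hp).mp (Dvd.intro N h.symm) with ⟨c, rfl⟩ | ⟨c, rfl⟩
  · exact .inl ⟨c, rfl, Nat.eq_of_mul_eq_mul_left hp.pos (by linarith)⟩
  · exact .inr ⟨c, rfl, Nat.eq_of_mul_eq_mul_left hp.pos (by linarith)⟩

theorem legendreSym_eq_one_of_dvd {q : ℕ} [Fact q.Prime] {u x z : ℤ}
    (h : (q : ℤ) ∣ u * x ^ 2 - z ^ 2) (hz : ¬ (q : ℤ) ∣ z) : legendreSym q u = 1 := by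
  rw [← ZMod.intCast_zmod_eq_zero_iff_dvd] at h hz
  push_cast at h
  have hu : (u : ZMod q) ≠ 0 := by
    intro hu
    rw [hu] at h
    apply hz
    simpa using h
  refine legendreSym.eq_one_of_sq_sub_mul_sq_eq_zero' hu hz (y := (x : ZMod q)) ?_
  linear_combination -h

theorem not_dvd_of_odd_of_dvd_two_pow {q : ℕ} [hq : Fact q.Prime] (hq2 : q ≠ 2) (k : ℕ) :
    ¬ (q : ℤ) ∣ 2 ^ k := by
  intro h
  have h' : q ∣ 2 ^ k := by exact_mod_cast h
  exact hq2 ((Nat.prime_dvd_prime_iff_eq hq.out Nat.prime_two).mp (hq.out.dvd_of_dvd_pow h'))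

/-! ### Residue conditions imposed by `d₁x² - d₂y² = 4^k` -/

section LegendreDescent

variable {q d₁ d₂ x y k : ℕ} [Fact q.Prime]

/-- Modulo `q` the term with `d₂` vanishes, and `2^k` is invertible. The exponent is general in
order to cover the right-hand sides `4` (`k = 1`) and `1` (`k = 0`). -/
theorem legendreSym_eq_one_of_dvd_right (hq2 : q ≠ 2)
    (h : (d₁ : ℤ) * x ^ 2 - d₂ * y ^ 2 = (2 ^ k) ^ 2) (hd : q ∣ d₂) :
    legendreSym q d₁ = 1 := by
  obtain ⟨c, rfl⟩ := hd
  refine legendreSym_eq_one_of_dvd (x := x) ⟨c * y ^ 2, ?_⟩ (not_dvd_of_odd_of_dvd_two_pow hq2 k)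
  push_cast at h
  linear_combination h

theorem legendreSym_neg_eq_one_of_dvd_left (hq2 : q ≠ 2)
    (h : (d₁ : ℤ) * x ^ 2 - d₂ * y ^ 2 = (2 ^ k) ^ 2) (hd : q ∣ d₁) :
    legendreSym q (-1) * legendreSym q d₂ = 1 := by
  obtain ⟨c, rfl⟩ := hd
  rw [← legendreSym.mul]
  refine legendreSym_eq_one_of_dvd (x := y) ⟨-c * x ^ 2, ?_⟩
    (not_dvd_of_odd_of_dvd_two_pow hq2 k)
  push_cast at h
  linear_combination h

end LegendreDescent

theorem legendreSym_of_mod_eight_eq_five {p : ℕ} [Fact p.Prime] (hp : p % 8 = 5) :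
    legendreSym p (-1) = 1 ∧ legendreSym p 2 = -1 := by
  have hp2 : p ≠ 2 := by rintro rfl; norm_num at hp
  rw [legendreSym.at_neg_one hp2, legendreSym.at_two hp2, ZMod.χ₄_nat_eq_if_mod_four,
    ZMod.χ₈_nat_eq_if_mod_eight]
  constructor <;> split_ifs <;> lia

theorem legendreSym_of_mod_eight_eq_three {q : ℕ} [Fact q.Prime] (hq : q % 8 = 3) :
    legendreSym q (-1) = -1 ∧ legendreSym q 2 = -1 := by
  have hp2 : q ≠ 2 := by rintro rfl; norm_num at hq
  rw [legendreSym.at_neg_one hp2, legendreSym.at_two hp2, ZMod.χ₄_nat_eq_if_mod_four,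
    ZMod.χ₈_nat_eq_if_mod_eight]
  constructor <;> split_ifs <;> lia

/-! ### Excluding factorizations of `D` and `2D` -/

section Descent

variable {p q₁ q₂ : ℕ} [Fact p.Prime] [Fact q₁.Prime] [Fact q₂.Prime]

/-- By reciprocity `p` and each `qᵢ` are nonresidues of one another, while `-1` is a residue of `p`
only. If `d₁` and `d₂` contain one `qᵢ` each, the factor without `p` is a single `qᵢ` and the
condition at `p` fails. The cases `d₁ = D` and `d₁ = p` fail at `q₁`. -/
theorem eq_of_mul_sq_sub_mul_sq_eq_four (hp : p % 8 = 5) (hq₁ : q₁ % 8 = 3) (hq₂ : q₂ % 8 = 3)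
    (hpq₁ : legendreSym q₁ p = -1) (hpq₂ : legendreSym q₂ p = -1) {d₁ d₂ x y : ℕ}
    (hd : d₁ * d₂ = p * q₁ * q₂) (h1 : d₁ ≠ 1)
    (h : (d₁ : ℤ) * x ^ 2 - d₂ * y ^ 2 = 4) : d₁ = q₁ * q₂ ∧ d₂ = p := by
  obtain ⟨hp1, -⟩ := legendreSym_of_mod_eight_eq_five hp
  obtain ⟨hq1, -⟩ := legendreSym_of_mod_eight_eq_three hq₁
  have hp2 : p ≠ 2 := by lia
  have hq₁2 : q₁ ≠ 2 := by lia
  have hq₂2 : q₂ ≠ 2 := by lia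
  have hr₁ : legendreSym p q₁ = -1 := by
    rw [← hpq₁, legendreSym.quadratic_reciprocity_one_mod_four (by lia) hq₁2]
  have hr₂ : legendreSym p q₂ = -1 := by
    rw [← hpq₂, legendreSym.quadratic_reciprocity_one_mod_four (by lia) hq₂2]
  have h' : (d₁ : ℤ) * x ^ 2 - d₂ * y ^ 2 = (2 ^ 1) ^ 2 := by rw [h]; norm_num
  have hR {q : ℕ} [Fact q.Prime] (hq : q ≠ 2) := legendreSym_eq_one_of_dvd_right hq h'
  have hL {q : ℕ} [Fact q.Prime] (hq : q ≠ 2) := legendreSym_neg_eq_one_of_dvd_left hq h'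
  rw [mul_assoc] at hd
  rcases (Fact.out : p.Prime).mul_eq_mul_cases hd with ⟨c, rfl, hc⟩ | ⟨c, rfl, hc⟩
  · exfalso
    rcases (Fact.out : q₁.Prime).mul_eq_mul_cases hc with ⟨e, rfl, he⟩ | ⟨e, rfl, he⟩
    · rcases (Nat.dvd_prime (Fact.out : q₂.Prime)).mp (Dvd.intro_left _ he) with rfl | rfl
      · have := hL hq₁2 ⟨p * e, by ring⟩
        rw [hq1] at this
        simp at this
      · have := hL hp2 (Dvd.intro _ rfl)
        rw [hp1, hr₂] at this
        simp at this
    · rcases (Nat.dvd_prime (Fact.out : q₂.Prime)).mp (Dvd.intro _ he) with rfl | rfl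
      · have := hR hq₁2 (Dvd.intro _ rfl)
        rw [mul_one, hpq₁] at this
        simp at this
      · have := hL hp2 (Dvd.intro _ rfl)
        have he1 : e = 1 := by
          simpa [(Fact.out : Nat.Prime _).ne_zero] using he
        rw [he1, mul_one, hp1, hr₁] at this
        simp at this
  · have := hR hp2 (Dvd.intro _ rfl)
    rcases (Fact.out : q₁.Prime).mul_eq_mul_cases hc with ⟨e, rfl, he⟩ | ⟨e, rfl, he⟩
    · rcases (Nat.dvd_prime (Fact.out : q₂.Prime)).mp (Dvd.intro _ he) with rfl | rfl
      · rw [mul_one, hr₁] at this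
        simp at this
      · have hc1 : c = 1 := by
          simpa [(Fact.out : Nat.Prime _).ne_zero] using he
        simp [hc1]
    · exfalso
      rcases (Nat.dvd_prime (Fact.out : q₂.Prime)).mp (Dvd.intro _ he) with rfl | rfl
      · exact h1 rfl
      · rw [hr₂] at this
        simp at this

/-- Only factorizations with `q₁` and `q₂` on the same side need symbols, which now include those of
`2` (always `-1`). The separated ones are kept, since there `√d₁` and `√(p d₁)` are outside `K₁` in
any case. -/
theorem eq_or_dvd_of_mul_sq_sub_mul_sq_eq_one (hp : p % 8 = 5) (hq₁ : q₁ % 8 = 3)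
    (hq₂ : q₂ % 8 = 3) (hpq₁ : legendreSym q₁ p = -1) (hpq₂ : legendreSym q₂ p = -1)
    {d₁ d₂ x y : ℕ} (hd : d₁ * d₂ = 2 * (p * q₁ * q₂)) (h1 : d₁ ≠ 1)
    (h : (d₁ : ℤ) * x ^ 2 - d₂ * y ^ 2 = 1) :
    (d₁ = 2 * p ∧ d₂ = q₁ * q₂) ∨ (q₁ ∣ d₁ ∧ q₂ ∣ d₂) ∨ (q₂ ∣ d₁ ∧ q₁ ∣ d₂) := by
  obtain ⟨hp1, hpt⟩ := legendreSym_of_mod_eight_eq_five hp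
  obtain ⟨hq1, hqt⟩ := legendreSym_of_mod_eight_eq_three hq₁
  have hp2 : p ≠ 2 := by lia
  have hq₁2 : q₁ ≠ 2 := by lia
  have hq₂2 : q₂ ≠ 2 := by lia
  have hr₁ : legendreSym p q₁ = -1 := by
    rw [← hpq₁, legendreSym.quadratic_reciprocity_one_mod_four (by lia) hq₁2]
  have hr₂ : legendreSym p q₂ = -1 := by
    rw [← hpq₂, legendreSym.quadratic_reciprocity_one_mod_four (by lia) hq₂2]
  have h' : (d₁ : ℤ) * x ^ 2 - d₂ * y ^ 2 = (2 ^ 0) ^ 2 := by rw [h]; norm_num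
  have hR {q : ℕ} [Fact q.Prime] (hq : q ≠ 2) := legendreSym_eq_one_of_dvd_right hq h'
  have hL {q : ℕ} [Fact q.Prime] (hq : q ≠ 2) := legendreSym_neg_eq_one_of_dvd_left hq h'
  have hcases {c e : ℕ} (hce : c * e = 2 * p) :
      (c = 1 ∧ e = 2 * p) ∨ (c = 2 ∧ e = p) ∨ (c = p ∧ e = 2) ∨ (c = 2 * p ∧ e = 1) := by
    have hp0 : p ≠ 0 := (Fact.out : p.Prime).ne_zero
    rcases Nat.prime_two.mul_eq_mul_cases hce with ⟨c, rfl, hc⟩ | ⟨c, rfl, hc⟩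
    · rcases (Nat.dvd_prime (Fact.out : p.Prime)).mp (Dvd.intro _ hc) with rfl | rfl
      · right; left; simpa using hc
      · right; right; right; exact ⟨rfl, by simpa [hp0] using hc⟩
    · rcases (Nat.dvd_prime (Fact.out : p.Prime)).mp (Dvd.intro _ hc) with rfl | rfl
      · left; simpa using hc
      · right; right; left; exact ⟨rfl, by simpa [hp0] using hc⟩
  rw [show 2 * (p * q₁ * q₂) = q₁ * (q₂ * (2 * p)) by ring] at hd
  rcases (Fact.out : q₁.Prime).mul_eq_mul_cases hd with ⟨c, rfl, hc⟩ | ⟨c, rfl, hc⟩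
  · rcases (Fact.out : q₂.Prime).mul_eq_mul_cases hc with ⟨e, rfl, he⟩ | ⟨e, rfl, -⟩
    · exfalso
      have hLq := hL hq₁2 (Dvd.intro _ rfl)
      rcases hcases he with ⟨rfl, rfl⟩ | ⟨rfl, rfl⟩ | ⟨rfl, rfl⟩ | ⟨rfl, rfl⟩
      · push_cast at hLq
        rw [legendreSym.mul, hq1, hqt, hpq₁] at hLq
        simp at hLq
      · have := hR hp2 dvd_rfl
        push_cast at this
        rw [legendreSym.mul, legendreSym.mul, hr₁, hr₂, hpt] at this
        simp at this
      · have := hL hp2 ⟨q₁ * q₂, by ring⟩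
        push_cast at this
        rw [hp1, hpt] at this
        simp at this
      · rw [hq1] at hLq
        simp at hLq
    · exact .inr (.inl ⟨Dvd.intro _ rfl, Dvd.intro _ rfl⟩)
  · rcases (Fact.out : q₂.Prime).mul_eq_mul_cases hc with ⟨e, rfl, -⟩ | ⟨e, rfl, he⟩
    · exact .inr (.inr ⟨Dvd.intro _ rfl, Dvd.intro _ rfl⟩)
    · have hRq := hR hq₁2 (Dvd.intro _ rfl)
      rcases hcases he with ⟨rfl, rfl⟩ | ⟨rfl, rfl⟩ | ⟨rfl, rfl⟩ | ⟨rfl, rfl⟩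
      · exact absurd rfl h1
      · push_cast at hRq
        rw [hqt] at hRq
        simp at hRq
      · rw [hpq₁] at hRq
        simp at hRq
      · left; simp

end Descent

/-! ### Square roots of the fundamental units -/

/-- Otherwise `√ε` would be a unit strictly between `1` and `ε`. This excludes `d₁ = 1` in the
factorizations. -/
theorem sqrt_fundamentalUnit_notMem_unitSet {d : ℕ} (hd : Squarefree d) (hd1 : ¬ IsSquare d) :
    √(fundamentalUnit d) ∉ unitSet (realQuadField d) := by
  intro hη
  obtain ⟨⟨-, h1ε⟩, hle⟩ := isLeast_fundamentalUnit hd hd1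
  have h1 : 1 < √(fundamentalUnit d) := by
    rw [Real.lt_sqrt zero_le_one]
    simpa using h1ε
  have := hle ⟨hη, h1⟩
  have := Real.sq_sqrt (zero_le_one.trans h1ε.le)
  nlinarith

/-- A unit of norm `-1` would give `m² ≡ -4` modulo `q`, making `-1` a square modulo a prime `≡ 3`
mod `4`. -/
theorem exists_fundamentalUnit_eq_of_prime_dvd {d q : ℕ} [Fact q.Prime] (hd : Squarefree d)
    (hd1 : ¬ IsSquare d) (hq : q % 8 = 3) (hqd : q ∣ d) :
    ∃ m n : ℕ, 0 < n ∧ fundamentalUnit d = (m + n * √(d : ℝ)) / 2 ∧ m ^ 2 = d * n ^ 2 + 4 := by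
  obtain ⟨⟨hε, h1ε⟩, -⟩ := isLeast_fundamentalUnit hd hd1
  obtain ⟨m, n, e, he, hx, h⟩ := exists_eq_half_of_mem_unitSet hd hd1 hε
  obtain ⟨hm, hn⟩ := pos_of_one_lt_half_add_mul_sqrt hd.ne_zero he h (hx ▸ h1ε)
  lift m to ℕ using hm.le
  lift n to ℕ using hn.le
  have he1 : e = 1 := by
    refine he.resolve_right ?_
    rintro rfl
    obtain ⟨c, rfl⟩ := hqd
    have := legendreSym_eq_one_of_dvd (q := q) (u := -1) (x := m) (z := 2 ^ 1)
      ⟨-(c * n ^ 2), by push_cast at h; linear_combination -h⟩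
      (not_dvd_of_odd_of_dvd_two_pow (by lia) 1)
    rw [(legendreSym_of_mod_eight_eq_three hq).1] at this
    simp at this
  subst he1
  refine ⟨m, n, by exact_mod_cast hn, by exact_mod_cast hx, ?_⟩
  have : (m : ℤ) ^ 2 = d * n ^ 2 + 4 := by linarith
  exact_mod_cast this

theorem sq_mod_eight (m : ℕ) :
    (m % 2 = 1 ∧ m ^ 2 % 8 = 1) ∨ (m % 4 = 2 ∧ m ^ 2 % 8 = 4) ∨ (m % 4 = 0 ∧ m ^ 2 % 8 = 0) := by
  have : m % 8 < 8 := Nat.mod_lt _ (by norm_num)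
  rw [Nat.pow_mod]
  interval_cases h : m % 8 <;> norm_num <;> lia

/-- The factors of `(m+2)(m-2) = d n²` are coprime if `m` is odd. If `m` is even, `d ≡ 5` mod `8`
forces `4 ∣ n`, and both factors become coprime after division by `4`. -/
theorem exists_factorization_of_sq_eq_mul_sq_add_four {d m n : ℕ} (hd : Squarefree d)
    (hd5 : d % 8 = 5) (hn : 0 < n) (h : m ^ 2 = d * n ^ 2 + 4) :
    ∃ d₁ d₂ x y : ℕ, d₁ * d₂ = d ∧ m + 2 = d₁ * x ^ 2 ∧ m = d₂ * y ^ 2 + 2 ∧ n = x * y := by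
  have hm2 : 2 < m := by
    have : 0 < d * n ^ 2 := Nat.mul_pos (by lia) (by positivity)
    by_contra! hm
    nlinarith
  obtain ⟨c, rfl⟩ := Nat.exists_eq_add_of_lt hm2
  rcases Nat.even_or_odd c with ⟨f, rfl⟩ | hc
  · -- `m` is odd
    have hcop : (2 + (f + f) + 1 + 2).Coprime (f + f + 1) := by
      rw [show 2 + (f + f) + 1 + 2 = (f + f + 1) + 2 ^ 2 by ring, Nat.coprime_self_add_left]
      exact Nat.Coprime.pow_left 2 (Nat.coprime_two_left.mpr ⟨f, by ring⟩)
    obtain ⟨d₁, d₂, x, y, h1, h2, h3, h4⟩ := hcop.exists_eq_mul_sq (N := d) (t := n)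
      (by nlinarith) hd hn.ne'
    exact ⟨d₁, d₂, x, y, h1, h2, by linarith, h4⟩
  · obtain ⟨f, rfl⟩ := hc
    have hdn : d * n ^ 2 % 8 = 5 * (n ^ 2 % 8) % 8 := by rw [Nat.mul_mod, hd5]
    rcases sq_mod_eight n with hn8 | ⟨hn4, -⟩ | ⟨hn4, -⟩
    · rcases sq_mod_eight (2 + (2 * f + 1) + 1) with hm8 | hm8 | hm8 <;> lia
    · exfalso
      obtain ⟨t, rfl⟩ : ∃ t, n = 2 * (2 * t + 1) := ⟨n / 4, by lia⟩
      -- The right-hand side is `6` modulo `8`, which is not a square.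
      have h' : (f + 2) ^ 2 = d * (2 * t + 1) ^ 2 + 1 := by nlinarith
      have hdt : d * (2 * t + 1) ^ 2 % 8 = 5 * ((2 * t + 1) ^ 2 % 8) % 8 := by
        rw [Nat.mul_mod, hd5]
      rcases sq_mod_eight (f + 2) with hf | hf | hf <;>
        rcases sq_mod_eight (2 * t + 1) with ht | ht | ht <;> lia
    · obtain ⟨t, rfl⟩ : ∃ t, n = 4 * t := ⟨n / 4, by lia⟩
      have h' : (f + 2) ^ 2 = d * (4 * t ^ 2) + 1 := by nlinarith
      obtain ⟨c, rfl⟩ : ∃ c, f = 2 * c + 1 := by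
        rcases Nat.even_or_odd f with ⟨c, rfl⟩ | ⟨c, rfl⟩
        · exfalso
          have : (c + c + 2) ^ 2 = 4 * (c + 1) ^ 2 := by ring
          have : d * (4 * t ^ 2) = 4 * (d * t ^ 2) := by ring
          lia
        · exact ⟨c, rfl⟩
      -- Here `m + 2 = 4(c + 2)`, `m - 2 = 4(c + 1)` and `(c + 2)(c + 1) = d t²`; the factors `4`
      -- are returned to `x` and `y` as `2x`, `2y`.
      obtain ⟨d₁, d₂, x, y, h1, h2, h3, h4⟩ :=
        ((Nat.coprime_self_add_left).mpr (Nat.coprime_one_left (c + 1))).exists_eq_mul_sq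
          (N := d) (t := t) (by nlinarith) hd (by lia)
      exact ⟨d₁, d₂, 2 * x, 2 * y, h1, by nlinarith, by nlinarith, by rw [h4]; ring⟩

/-- Successive parity arguments give `m = 2(2c + 1)` and `n = 4t`, and the equation becomes `(c +
1)c = 2d t²` with coprime factors. -/
theorem exists_factorization_of_sq_eq_two_mul_mul_sq_add_four {d m n : ℕ}
    (hd : Squarefree (2 * d)) (hdo : d % 2 = 1) (hn : 0 < n) (h : m ^ 2 = 2 * d * n ^ 2 + 4) :
    ∃ d₁ d₂ x y : ℕ, d₁ * d₂ = 2 * d ∧ d₁ * x ^ 2 = d₂ * y ^ 2 + 1 ∧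
      m = 2 * (d₁ * x ^ 2 + d₂ * y ^ 2) ∧ n = 4 * (x * y) := by
  have hdm (k : ℕ) : d * k % 2 = k % 2 := by rw [Nat.mul_mod, hdo]; simp
  have hp (k : ℕ) : k ^ 2 % 2 = k % 2 := by
    rcases Nat.mod_two_eq_zero_or_one k with h | h <;> simp [Nat.pow_mod, h]
  obtain ⟨r, rfl⟩ : ∃ r, m = 2 * r := ⟨m / 2, by have := hp m; lia⟩
  have h1 : 2 * r ^ 2 = d * n ^ 2 + 2 := by linarith
  obtain ⟨s, rfl⟩ : ∃ s, n = 2 * s := ⟨n / 2, by have := hp n; have := hdm (n ^ 2); lia⟩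
  have h2 : r ^ 2 = 2 * (d * s ^ 2) + 1 := by linarith
  obtain ⟨c, rfl⟩ : ∃ c, r = 2 * c + 1 := ⟨r / 2, by have := hp r; lia⟩
  have h3 : 2 * (c ^ 2 + c) = d * s ^ 2 := by linarith
  obtain ⟨t, rfl⟩ : ∃ t, s = 2 * t := ⟨s / 2, by have := hp s; have := hdm (s ^ 2); lia⟩
  obtain ⟨d₁, d₂, x, y, h1, h2, h3, h4⟩ :=
    ((Nat.coprime_self_add_left).mpr (Nat.coprime_one_left c)).exists_eq_mul_sq
      (N := 2 * d) (t := t) (by linarith) hd (by lia)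
  exact ⟨d₁, d₂, x, y, h1, by lia, by lia, by rw [h4]; ring⟩

theorem sqrt_eq_of_sq_eq_half {d d₁ d₂ x y : ℕ} (h : d₁ * d₂ = d) {ε : ℝ}
    (hε : ε = d₁ * x ^ 2 + d₂ * y ^ 2 + 2 * (x * y) * √(d : ℝ)) :
    √ε = x * √(d₁ : ℝ) + y * √(d₂ : ℝ) := by
  have h1 : √(d₁ : ℝ) ^ 2 = d₁ := Real.sq_sqrt d₁.cast_nonneg
  have h2 : √(d₂ : ℝ) ^ 2 = d₂ := Real.sq_sqrt d₂.cast_nonneg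
  rw [Real.sqrt_eq_iff_eq_sq _ (by positivity), hε, ← h, sqrt_natCast_mul]
  · linear_combination (-(x ^ 2 : ℝ)) * h1 - (y ^ 2 : ℝ) * h2
  · rw [hε]; positivity

/-- The conditions on the primes `p`, `q₁`, `q₂`: `p ≡ 5` and `q₁ ≡ q₂ ≡ 3` modulo `8`, the primes
`q₁`, `q₂` are distinct, and `p` is a quadratic nonresidue modulo both of them. -/
structure AdmissiblePrimes (p q₁ q₂ : ℕ) [Fact p.Prime] [Fact q₁.Prime] [Fact q₂.Prime] :
    Prop where
  mod_p : p % 8 = 5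
  mod_q₁ : q₁ % 8 = 3
  mod_q₂ : q₂ % 8 = 3
  ne : q₁ ≠ q₂
  legendre₁ : legendreSym q₁ (p : ℤ) = -1
  legendre₂ : legendreSym q₂ (p : ℤ) = -1

namespace AdmissiblePrimes

variable {p q₁ q₂ : ℕ} [hp : Fact p.Prime] [hq₁ : Fact q₁.Prime] [hq₂ : Fact q₂.Prime]

theorem squarefree_two_mul (H : AdmissiblePrimes p q₁ q₂) : Squarefree (2 * (p * q₁ * q₂)) := by
  obtain ⟨h1, h2, h3, h4, -, -⟩ := H
  have hc {a b : ℕ} (ha : a.Prime) (hb : b.Prime) (h : a ≠ b) : a.Coprime b :=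
    (Nat.coprime_primes ha hb).mpr h
  have c1 : p.Coprime q₁ := hc hp.out hq₁.out (by lia)
  have c2 : p.Coprime q₂ := hc hp.out hq₂.out (by lia)
  have c3 : q₁.Coprime q₂ := hc hq₁.out hq₂.out h4
  have c4 : Nat.Coprime 2 p := hc Nat.prime_two hp.out (by lia)
  have c5 : Nat.Coprime 2 q₁ := hc Nat.prime_two hq₁.out (by lia)
  have c6 : Nat.Coprime 2 q₂ := hc Nat.prime_two hq₂.out (by lia)
  rw [Nat.squarefree_mul ((c4.mul_right c5).mul_right c6),
    Nat.squarefree_mul (c2.mul_left c3), Nat.squarefree_mul c1]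
  exact ⟨Nat.prime_two.prime.squarefree, ⟨hp.out.prime.squarefree, hq₁.out.prime.squarefree⟩,
    hq₂.out.prime.squarefree⟩

theorem squarefree (H : AdmissiblePrimes p q₁ q₂) : Squarefree (p * q₁ * q₂) :=
  H.squarefree_two_mul.squarefree_of_dvd (Dvd.intro_left _ rfl)

theorem mod_eight (H : AdmissiblePrimes p q₁ q₂) : p * q₁ * q₂ % 8 = 5 := by
  rw [Nat.mul_mod, Nat.mul_mod p, H.mod_p, H.mod_q₁, H.mod_q₂]

theorem not_isSquare (H : AdmissiblePrimes p q₁ q₂) : ¬ IsSquare (p * q₁ * q₂) :=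
  H.squarefree.not_isSquare_of_ne_one (by have := H.mod_eight; lia)

theorem not_isSquare_two_mul (H : AdmissiblePrimes p q₁ q₂) : ¬ IsSquare (2 * (p * q₁ * q₂)) :=
  H.squarefree_two_mul.not_isSquare_of_ne_one (by lia)

/-- The square root of `ε_D`. -/
theorem exists_sqrt_fundamentalUnit (H : AdmissiblePrimes p q₁ q₂) :
    ∃ x y : ℕ, q₁ * q₂ * x ^ 2 = p * y ^ 2 + 4 ∧
      √(fundamentalUnit (p * q₁ * q₂)) = (x * √((q₁ * q₂ : ℕ) : ℝ) + y * √(p : ℝ)) / 2 := by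
  obtain ⟨m, n, hn, hε, h⟩ := exists_fundamentalUnit_eq_of_prime_dvd (q := q₁) H.squarefree
    H.not_isSquare H.mod_q₁ ⟨p * q₂, by ring⟩
  obtain ⟨d₁, d₂, x, y, hd, h1, h2, rfl⟩ :=
    exists_factorization_of_sq_eq_mul_sq_add_four H.squarefree H.mod_eight hn h
  have h3 : d₁ * x ^ 2 = d₂ * y ^ 2 + 4 := by lia
  have hm1 : (m : ℝ) + 2 = d₁ * x ^ 2 := by exact_mod_cast h1
  have hm2 : (m : ℝ) = d₂ * y ^ 2 + 2 := by exact_mod_cast h2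
  have h4 : √(fundamentalUnit (p * q₁ * q₂)) = (x * √(d₁ : ℝ) + y * √(d₂ : ℝ)) / 2 := by
    -- Passing to `4ε_D = (m + 2) + (m - 2) + 2xy√D` clears the denominator.
    rw [← sqrt_eq_of_sq_eq_half (ε := 4 * fundamentalUnit (p * q₁ * q₂)) hd,
      Real.sqrt_mul (by norm_num), show (4 : ℝ) = 2 ^ 2 by norm_num,
      Real.sqrt_sq (by norm_num)]
    · ring
    · rw [hε]
      push_cast
      linear_combination hm1 + hm2
  have h5 : (d₁ : ℤ) * x ^ 2 - d₂ * y ^ 2 = 4 := by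
    have : (d₁ : ℤ) * x ^ 2 = d₂ * y ^ 2 + 4 := by exact_mod_cast h3
    linarith
  obtain ⟨rfl, rfl⟩ := eq_of_mul_sq_sub_mul_sq_eq_four H.mod_p H.mod_q₁ H.mod_q₂ H.legendre₁
    H.legendre₂ hd (by
      rintro rfl
      rw [one_mul] at hd
      subst hd
      -- With `d₁ = 1` the root `√ε_D = (x + y√D)/2` would itself be a unit of `K`.
      have hunit := half_add_mul_sqrt_mem_unitSet (d := p * q₁ * q₂) (m := x) (n := y) (.inl rfl)
        (by push_cast at h5 ⊢; linarith)
      refine sqrt_fundamentalUnit_notMem_unitSet H.squarefree H.not_isSquare ?_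
      rw [h4]
      simpa using hunit) h5
  exact ⟨x, y, h3, h4⟩

/-- The square root of `ε_{2D}`. -/
theorem exists_sqrt_fundamentalUnit_two_mul (H : AdmissiblePrimes p q₁ q₂) :
    ∃ d₁ d₂ a b : ℕ, d₁ * d₂ = 2 * (p * q₁ * q₂) ∧ 0 < a ∧ d₁ * a ^ 2 = d₂ * b ^ 2 + 1 ∧
      fundamentalUnit (2 * (p * q₁ * q₂)) = ((d₁ * a ^ 2 + d₂ * b ^ 2 : ℕ) : ℤ)
        + ((2 * (a * b) : ℕ) : ℤ) * √((2 * (p * q₁ * q₂) : ℕ) : ℝ) ∧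
      √(fundamentalUnit (2 * (p * q₁ * q₂))) = a * √(d₁ : ℝ) + b * √(d₂ : ℝ) ∧
      ((d₁ = 2 * p ∧ d₂ = q₁ * q₂) ∨ (q₁ ∣ d₁ ∧ q₂ ∣ d₂) ∨ (q₂ ∣ d₁ ∧ q₁ ∣ d₂)) := by
  obtain ⟨m, n, hn, hε, h⟩ := exists_fundamentalUnit_eq_of_prime_dvd (q := q₁)
    H.squarefree_two_mul H.not_isSquare_two_mul H.mod_q₁ ⟨2 * (p * q₂), by ring⟩
  obtain ⟨d₁, d₂, x, y, hd, h1, rfl, rfl⟩ :=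
    exists_factorization_of_sq_eq_two_mul_mul_sq_add_four H.squarefree_two_mul
      (by have := H.mod_eight; lia) hn h
  have hε' : fundamentalUnit (2 * (p * q₁ * q₂)) =
      d₁ * x ^ 2 + d₂ * y ^ 2 + 2 * (x * y) * √((2 * (p * q₁ * q₂) : ℕ) : ℝ) := by
    rw [hε]
    push_cast
    ring
  have h4 := sqrt_eq_of_sq_eq_half hd hε'
  have h5 : (d₁ : ℤ) * x ^ 2 - d₂ * y ^ 2 = 1 := by
    have : (d₁ : ℤ) * x ^ 2 = d₂ * y ^ 2 + 1 := by exact_mod_cast h1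
    linarith
  refine ⟨d₁, d₂, x, y, hd, Nat.pos_of_ne_zero ?_, h1, by rw [hε']; push_cast; ring, h4,
    eq_or_dvd_of_mul_sq_sub_mul_sq_eq_one H.mod_p H.mod_q₁ H.mod_q₂ H.legendre₁ H.legendre₂ hd ?_
      h5⟩
  · rintro rfl
    simp at hn
  · rintro rfl
    rw [one_mul] at hd
    subst hd
    have hunit := half_add_mul_sqrt_mem_unitSet (d := 2 * (p * q₁ * q₂)) (m := 2 * x)
      (n := 2 * y) (.inl rfl) (by push_cast at h5 ⊢; linarith)
    refine sqrt_fundamentalUnit_notMem_unitSet H.squarefree_two_mul H.not_isSquare_two_mul ?_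
    rw [h4]
    convert hunit using 1
    push_cast
    rw [Real.sqrt_one]
    ring

end AdmissiblePrimes

/-! ### Square roots in the biquadratic field -/

theorem sq_dvd_of_isSquare {l n : ℕ} (hl : l.Prime) (h : IsSquare n) (hn : l ∣ n) :
    l ^ 2 ∣ n := by
  obtain ⟨k, rfl⟩ := h
  rw [← sq] at hn ⊢
  exact pow_dvd_pow_of_dvd (hl.dvd_of_dvd_pow hn) 2

/-- Each of the four possible squares contains a prime exactly once: `l₁` in `n` and `2n`, and `l₂`
in `nd` and `2nd`. -/
theorem sqrt_notMem_realBiquadField {n d l₁ l₂ : ℕ} (hd : ¬ IsSquare d)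
    (h2d : Squarefree (2 * d)) (hl₁ : l₁.Prime) (hl₂ : l₂.Prime) (hl₁2 : l₁ ≠ 2)
    (h₁ : l₁ ∣ n) (h₁' : ¬ l₁ ^ 2 ∣ n) (h₂ : ¬ l₂ ∣ n) (hd₂ : l₂ ∣ d) :
    √(n : ℝ) ∉ realBiquadField d := by
  have hd₂' (c : ℕ) (hc : c ∣ 2 * d) : ¬ l₂ ^ 2 ∣ n * c := by
    intro h
    have h' : l₂ ^ 2 ∣ c :=
      (Nat.Coprime.pow_left 2 ((Nat.Prime.coprime_iff_not_dvd hl₂).mpr h₂)).dvd_of_dvd_mul_left h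
    rw [sq] at h'
    exact hl₂.one_lt.ne' (Nat.isUnit_iff.mp (h2d _ (h'.trans hc)))
  intro h
  rcases isSquare_or_of_sqrt_mem_realBiquadField hd
    (h2d.not_isSquare_of_ne_one (by lia)) h with h | h | h | h
  · exact h₁' (sq_dvd_of_isSquare hl₁ h h₁)
  · exact hd₂' d (Dvd.intro_left _ rfl) (sq_dvd_of_isSquare hl₂ h (hd₂.mul_left _))
  · refine h₁' (Nat.Coprime.dvd_of_dvd_mul_right ?_
      (sq_dvd_of_isSquare hl₁ h (h₁.mul_right 2)))
    exact Nat.Coprime.pow_left 2 ((Nat.coprime_primes hl₁ Nat.prime_two).mpr hl₁2)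
  · exact hd₂' _ dvd_rfl (sq_dvd_of_isSquare hl₂ h ((hd₂.mul_left 2).mul_left n))

/-- Since `√d₁ √d₂ = √(2d)`, the product is `a d₁ + b√(2d)`. Thus `√ε_{2d}` may be replaced by `√d₁`
when testing membership. -/
theorem sqrt_mul_sqrt_fundamentalUnit_two_mul_mem {d d₁ d₂ a b : ℕ} (hd : d₁ * d₂ = 2 * d)
    (h : √(fundamentalUnit (2 * d)) = a * √(d₁ : ℝ) + b * √(d₂ : ℝ)) :
    √(d₁ : ℝ) * √(fundamentalUnit (2 * d)) ∈ realBiquadField d := by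
  apply realQuadField_two_mul_le
  refine mem_realQuadField_iff.mpr ⟨a * d₁, b, ?_⟩
  have h1 : √(d₁ : ℝ) ^ 2 = d₁ := Real.sq_sqrt d₁.cast_nonneg
  rw [h, ← hd, sqrt_natCast_mul]
  push_cast
  linear_combination (a : ℝ) * h1

namespace AdmissiblePrimes

variable {p q₁ q₂ : ℕ} [hp : Fact p.Prime] [hq₁ : Fact q₁.Prime] [hq₂ : Fact q₂.Prime]

theorem symm (H : AdmissiblePrimes p q₁ q₂) : AdmissiblePrimes p q₂ q₁ :=
  ⟨H.mod_p, H.mod_q₂, H.mod_q₁, H.ne.symm, H.legendre₂, H.legendre₁⟩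

theorem one_lt_fundamentalUnit (H : AdmissiblePrimes p q₁ q₂) :
    1 < fundamentalUnit (p * q₁ * q₂) :=
  (isLeast_fundamentalUnit H.squarefree H.not_isSquare).1.2

theorem one_lt_fundamentalUnit_two_mul (H : AdmissiblePrimes p q₁ q₂) :
    1 < fundamentalUnit (2 * (p * q₁ * q₂)) :=
  (isLeast_fundamentalUnit H.squarefree_two_mul H.not_isSquare_two_mul).1.2

theorem not_dvd_p (H : AdmissiblePrimes p q₁ q₂) : ¬ q₁ ∣ p := by
  intro h
  have := (Nat.prime_dvd_prime_iff_eq hq₁.out hp.out).mp h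
  have := H.mod_p
  have := H.mod_q₁
  lia

theorem sqrt_p_notMem (H : AdmissiblePrimes p q₁ q₂) :
    √(p : ℝ) ∉ realBiquadField (p * q₁ * q₂) := by
  refine sqrt_notMem_realBiquadField H.not_isSquare H.squarefree_two_mul hp.out hq₁.out
    (by have := H.mod_p; lia) dvd_rfl ?_ H.not_dvd_p ⟨p * q₂, by ring⟩
  intro h
  have := Nat.le_of_dvd hp.out.pos h
  have := hp.out.one_lt
  nlinarith

theorem sqrt_two_mul_p_notMem (H : AdmissiblePrimes p q₁ q₂) :
    √((2 * p : ℕ) : ℝ) ∉ realBiquadField (p * q₁ * q₂) := by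
  intro h
  apply H.sqrt_p_notMem
  have h2 : √(2 : ℝ) ≠ 0 := by positivity
  rw [sqrt_two_natCast_mul] at h
  rw [← mul_div_cancel_left₀ √(p : ℝ) h2]
  exact div_mem h (sqrt_two_mem_realBiquadField _)

theorem sqrt_notMem_of_dvd (H : AdmissiblePrimes p q₁ q₂) {d₁ d₂ : ℕ}
    (hd : d₁ * d₂ = 2 * (p * q₁ * q₂)) (h₁ : q₁ ∣ d₁) (h₂ : q₂ ∣ d₂) :
    √(d₁ : ℝ) ∉ realBiquadField (p * q₁ * q₂) ∧
      √((p * d₁ : ℕ) : ℝ) ∉ realBiquadField (p * q₁ * q₂) := by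
  have hsq := H.squarefree_two_mul
  have hodd : q₁ ≠ 2 := by have := H.mod_q₁; lia
  have hdvd : q₂ ∣ p * q₁ * q₂ := Dvd.intro_left _ rfl
  have h1' : ¬ q₁ ^ 2 ∣ d₁ := by
    intro h
    rw [sq] at h
    exact hq₁.out.one_lt.ne' (Nat.isUnit_iff.mp (hsq _ (h.trans (Dvd.intro _ hd))))
  have h2' : ¬ q₂ ∣ d₁ := by
    intro h
    exact hq₂.out.one_lt.ne' (Nat.isUnit_iff.mp (hsq _ (hd ▸ mul_dvd_mul h h₂)))
  refine ⟨sqrt_notMem_realBiquadField H.not_isSquare hsq hq₁.out hq₂.out hodd h₁ h1' h2' hdvd,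
    sqrt_notMem_realBiquadField H.not_isSquare hsq hq₁.out hq₂.out hodd (h₁.mul_left p) ?_ ?_
      hdvd⟩
  · intro h
    exact h1' ((Nat.Coprime.pow_left 2
      ((Nat.Prime.coprime_iff_not_dvd hq₁.out).mpr H.not_dvd_p)).dvd_of_dvd_mul_left h)
  · rw [hq₂.out.dvd_mul, not_or]
    exact ⟨H.symm.not_dvd_p, h2'⟩

/-- The product is `(py + x√D)/2`, so `√ε_D` may be replaced by `√p` when testing membership. -/
theorem sqrt_p_mul_sqrt_fundamentalUnit_mem (H : AdmissiblePrimes p q₁ q₂) :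
    √(p : ℝ) * √(fundamentalUnit (p * q₁ * q₂)) ∈ realBiquadField (p * q₁ * q₂) := by
  obtain ⟨x, y, -, h⟩ := H.exists_sqrt_fundamentalUnit
  apply realQuadField_le
  refine mem_realQuadField_iff.mpr ⟨p * y / 2, x / 2, ?_⟩
  have h1 : √(p : ℝ) ^ 2 = p := Real.sq_sqrt p.cast_nonneg
  rw [h, mul_assoc, sqrt_natCast_mul p]
  push_cast
  linear_combination (y / 2 : ℝ) * h1

theorem sqrt_fundamentalUnit_ne_zero (H : AdmissiblePrimes p q₁ q₂) :
    √(fundamentalUnit (p * q₁ * q₂)) ≠ 0 ∧ √(fundamentalUnit (2 * (p * q₁ * q₂))) ≠ 0 :=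
  ⟨(Real.sqrt_pos.mpr (zero_lt_one.trans H.one_lt_fundamentalUnit)).ne',
    (Real.sqrt_pos.mpr (zero_lt_one.trans H.one_lt_fundamentalUnit_two_mul)).ne'⟩

theorem sqrt_fundamentalUnit_notMem (H : AdmissiblePrimes p q₁ q₂) :
    √(fundamentalUnit (p * q₁ * q₂)) ∉ realBiquadField (p * q₁ * q₂) := by
  intro h
  apply H.sqrt_p_notMem
  rw [← mul_div_cancel_right₀ √(p : ℝ) H.sqrt_fundamentalUnit_ne_zero.1]
  exact div_mem H.sqrt_p_mul_sqrt_fundamentalUnit_mem h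

theorem sqrt_fundamentalUnit_two_mul_notMem (H : AdmissiblePrimes p q₁ q₂) :
    √(fundamentalUnit (2 * (p * q₁ * q₂))) ∉ realBiquadField (p * q₁ * q₂) := by
  intro h
  obtain ⟨d₁, d₂, a, b, hd, -, -, -, hε, hcases⟩ := H.exists_sqrt_fundamentalUnit_two_mul
  have hmem : √(d₁ : ℝ) ∈ realBiquadField (p * q₁ * q₂) := by
    rw [← mul_div_cancel_right₀ √(d₁ : ℝ) H.sqrt_fundamentalUnit_ne_zero.2]
    exact div_mem (sqrt_mul_sqrt_fundamentalUnit_two_mul_mem hd hε) h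
  rcases hcases with ⟨rfl, -⟩ | ⟨h1, h2⟩ | ⟨h1, h2⟩
  · exact H.sqrt_two_mul_p_notMem hmem
  · exact (H.sqrt_notMem_of_dvd hd h1 h2).1 hmem
  · rw [mul_right_comm] at hmem hd
    exact (H.symm.sqrt_notMem_of_dvd hd h1 h2).1 hmem

theorem sqrt_mul_mem_iff (H : AdmissiblePrimes p q₁ q₂) {d₁ d₂ a b : ℕ}
    (hd : d₁ * d₂ = 2 * (p * q₁ * q₂))
    (h : √(fundamentalUnit (2 * (p * q₁ * q₂))) = a * √(d₁ : ℝ) + b * √(d₂ : ℝ)) :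
    √(fundamentalUnit (p * q₁ * q₂) * fundamentalUnit (2 * (p * q₁ * q₂))) ∈
      realBiquadField (p * q₁ * q₂) ↔ √((p * d₁ : ℕ) : ℝ) ∈ realBiquadField (p * q₁ * q₂) := by
  have hε := H.sqrt_fundamentalUnit_ne_zero
  have hp0 : √(p : ℝ) ≠ 0 := (Real.sqrt_pos.mpr (by exact_mod_cast hp.out.pos)).ne'
  have hd0 : √(d₁ : ℝ) ≠ 0 := by
    refine (Real.sqrt_pos.mpr ?_).ne'
    have : d₁ ≠ 0 := by
      rintro rfl
      rw [zero_mul] at hd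
      exact H.squarefree_two_mul.ne_zero hd.symm
    positivity
  have h1 := mul_mem H.sqrt_p_mul_sqrt_fundamentalUnit_mem
    (sqrt_mul_sqrt_fundamentalUnit_two_mul_mem hd h)
  rw [Real.sqrt_mul (zero_le_one.trans H.one_lt_fundamentalUnit.le), sqrt_natCast_mul]
  set u := √(fundamentalUnit (p * q₁ * q₂))
  set v := √(fundamentalUnit (2 * (p * q₁ * q₂)))
  constructor <;> intro h2
  · convert div_mem h1 h2 using 1
    have := hε.1
    have := hε.2
    field_simp
  · convert div_mem h1 h2 using 1
    field_simp

/-- The criterion for `√(ε_D ε_{2D})` to lie in `ℚ(√2, √D)`. -/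
theorem sqrt_mul_mem_iff_eq (H : AdmissiblePrimes p q₁ q₂) {d₁ d₂ a b : ℕ}
    (hd : d₁ * d₂ = 2 * (p * q₁ * q₂))
    (h : √(fundamentalUnit (2 * (p * q₁ * q₂))) = a * √(d₁ : ℝ) + b * √(d₂ : ℝ))
    (hcases : (d₁ = 2 * p ∧ d₂ = q₁ * q₂) ∨ (q₁ ∣ d₁ ∧ q₂ ∣ d₂) ∨ (q₂ ∣ d₁ ∧ q₁ ∣ d₂)) :
    √(fundamentalUnit (p * q₁ * q₂) * fundamentalUnit (2 * (p * q₁ * q₂))) ∈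
      realBiquadField (p * q₁ * q₂) ↔ d₁ = 2 * p ∧ d₂ = q₁ * q₂ := by
  rw [H.sqrt_mul_mem_iff hd h]
  constructor
  · intro hmem
    rcases hcases with h | ⟨h1, h2⟩ | ⟨h1, h2⟩
    · exact h
    · exact absurd hmem (H.sqrt_notMem_of_dvd hd h1 h2).2
    · rw [mul_right_comm p q₁] at hmem hd
      exact absurd hmem (H.symm.sqrt_notMem_of_dvd hd h1 h2).2
  · rintro ⟨rfl, -⟩
    rw [mul_left_comm, sqrt_two_natCast_mul, sqrt_natCast_mul,
      Real.mul_self_sqrt p.cast_nonneg]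
    exact mul_mem (sqrt_two_mem_realBiquadField _) (natCast_mem_intermediateField _ p)

/-- From `d₁a² - d₂b² = 1` and `r = d₁a² + d₂b²` follows `p(r + 1) = p d₁ · 2a²`. As `√2 ∈ K₁`, this
being a square puts `√(p d₁)` into `K₁`; conversely `d₁ = 2p` makes it `(2pa)²`. -/
theorem exists_sqrt_mul_mem_iff_isSquare (H : AdmissiblePrimes p q₁ q₂) :
    ∃ r s : ℤ, fundamentalUnit (2 * (p * q₁ * q₂)) =
        r + s * √((2 * (p * q₁ * q₂) : ℕ) : ℝ) ∧
      (√(fundamentalUnit (p * q₁ * q₂) * fundamentalUnit (2 * (p * q₁ * q₂))) ∈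
        realBiquadField (p * q₁ * q₂) ↔ IsSquare ((p : ℤ) * (r + 1))) := by
  obtain ⟨d₁, d₂, a, b, hd, ha, hab, hε, hsqrt, hcases⟩ := H.exists_sqrt_fundamentalUnit_two_mul
  refine ⟨_, _, hε, ?_⟩
  have hr : (p : ℤ) * ((d₁ * a ^ 2 + d₂ * b ^ 2 : ℕ) + 1) = ((p * d₁) * (2 * a ^ 2) : ℕ) := by
    have : (d₁ : ℤ) * a ^ 2 = d₂ * b ^ 2 + 1 := by exact_mod_cast hab
    push_cast
    linear_combination (-p : ℤ) * this
  rw [hr, Int.isSquare_natCast_iff]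
  constructor
  · intro hmem
    obtain ⟨rfl, -⟩ := (H.sqrt_mul_mem_iff_eq hd hsqrt hcases).mp hmem
    exact ⟨2 * p * a, by ring⟩
  · intro hsq
    rw [H.sqrt_mul_mem_iff hd hsqrt]
    have ha0 : (a : ℝ) ≠ 0 := by positivity
    have h2 : √(2 : ℝ) ≠ 0 := by positivity
    obtain ⟨k, hk⟩ := hsq
    have hk' : √((p * d₁ : ℕ) : ℝ) * (√2 * a) = k := by
      have := congrArg (fun n : ℕ ↦ √(n : ℝ)) hk
      rw [sqrt_natCast_mul, Nat.cast_mul k, Real.sqrt_mul_self k.cast_nonneg] at this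
      rw [← this, sqrt_two_natCast_mul, Nat.cast_pow, Real.sqrt_sq a.cast_nonneg]
    rw [eq_div_of_mul_eq (mul_ne_zero h2 ha0) hk']
    exact div_mem (natCast_mem_intermediateField _ k)
      (mul_mem (sqrt_two_mem_realBiquadField _) (natCast_mem_intermediateField _ a))

end AdmissiblePrimes

/-! ### Norms from the biquadratic field -/

section Norms

variable {d : ℕ}

theorem sqrt_two_notMem_realQuadField (hd : ¬ IsSquare d) (h2d : ¬ IsSquare (2 * d)) :
    √(2 : ℝ) ∉ realQuadField d := by
  intro h
  rcases isSquare_or_of_sqrt_mem_realQuadField (n := 2) hd (by exact_mod_cast h) with h | h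
  · exact Nat.prime_two.prime.not_isSquare h
  · exact h2d h

theorem sqrt_two_notMem_realQuadField_two_mul (hd : ¬ IsSquare d) (h2d : ¬ IsSquare (2 * d)) :
    √(2 : ℝ) ∉ realQuadField (2 * d) := by
  intro h
  apply hd
  have h' : √(d : ℝ) ∈ realQuadField (2 * d) := by
    have := div_mem (sqrt_mem_realQuadField (2 * d)) h
    rwa [sqrt_two_natCast_mul, mul_div_cancel_left₀ _ (by positivity)] at this
  rcases isSquare_or_of_sqrt_mem_realQuadField h2d h' with h | ⟨k, hk⟩
  · exact h
  · have hd0 : d ≠ 0 := fun h ↦ hd ⟨0, by simp [h]⟩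
    exfalso
    have h2 : (d * d) * 2 = k * k := by rw [← hk]; ring
    have hsq := Nat.prime_two.prime.squarefree.eq_of_mul_sq_eq squarefree_one (s := d) (t := k)
      hd0 (by rw [one_mul, sq, sq, ← h2]; ring)
    simp at hsq

theorem sqrt_notMem_realQuadField_two (hd : ¬ IsSquare d) (h2d : ¬ IsSquare (2 * d)) :
    √(d : ℝ) ∉ realQuadField 2 := by
  intro h
  rcases isSquare_or_of_sqrt_mem_realQuadField Nat.prime_two.prime.not_isSquare h with h | h
  · exact hd h
  · exact h2d (by rwa [mul_comm] at h)

theorem sqrt_two_sq_mem (F : IntermediateField ℚ ℝ) : √(2 : ℝ) ^ 2 ∈ F := by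
  exact_mod_cast sqrt_natCast_sq_mem F 2

theorem relNorm_realQuadField (hd : ¬ IsSquare d) (h2d : ¬ IsSquare (2 * d)) {x : ℝ}
    (hx : x ∈ realBiquadField d) {a b c e : ℚ}
    (h : x = a + b * √2 + c * √(d : ℝ) + e * (√2 * √(d : ℝ))) :
    (relNorm (realQuadField_le d) ⟨x, hx⟩ : ℝ) =
      (a + c * √(d : ℝ)) ^ 2 - 2 * (b + e * √(d : ℝ)) ^ 2 := by
  rw [relNorm_add_mul_sqrt _ (sqrt_two_mem_realBiquadField d)
    (sqrt_two_notMem_realQuadField hd h2d) (sqrt_two_sq_mem _)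
    (fun x hx ↦ exists_realQuadField_add_mul_sqrt_two hx) hx
    (mem_realQuadField_iff.mpr ⟨a, c, rfl⟩) (mem_realQuadField_iff.mpr ⟨b, e, rfl⟩)
    (by rw [h]; ring), Real.sq_sqrt zero_le_two]
  ring

theorem relNorm_realQuadField_two_mul (hd : ¬ IsSquare d) (h2d : ¬ IsSquare (2 * d)) {x : ℝ}
    (hx : x ∈ realBiquadField d) {a b c e : ℚ}
    (h : x = a + b * √2 + c * √(d : ℝ) + e * (√2 * √(d : ℝ))) :
    (relNorm (realQuadField_two_mul_le d) ⟨x, hx⟩ : ℝ) =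
      (a + e * (√2 * √(d : ℝ))) ^ 2 - 2 * (b + c / 2 * (√2 * √(d : ℝ))) ^ 2 := by
  have h2 : √(2 : ℝ) ^ 2 = 2 := Real.sq_sqrt zero_le_two
  rw [relNorm_add_mul_sqrt _ (sqrt_two_mem_realBiquadField d)
    (sqrt_two_notMem_realQuadField_two_mul hd h2d) (sqrt_two_sq_mem _)
    (fun x hx ↦ exists_realQuadField_two_mul_add_mul_sqrt_two hx) hx
    (mem_realQuadField_iff.mpr ⟨a, e, rfl⟩) (mem_realQuadField_iff.mpr ⟨b, c / 2, rfl⟩), h2,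
    sqrt_two_natCast_mul]
  · push_cast
    ring
  · rw [h, sqrt_two_natCast_mul]
    push_cast
    linear_combination (-(c / 2 * √(d : ℝ)) : ℝ) * h2

theorem relNorm_realQuadField_two (hd : ¬ IsSquare d) (h2d : ¬ IsSquare (2 * d)) {x : ℝ}
    (hx : x ∈ realBiquadField d) {a b c e : ℚ}
    (h : x = a + b * √2 + c * √(d : ℝ) + e * (√2 * √(d : ℝ))) :
    (relNorm (realQuadField_two_le d) ⟨x, hx⟩ : ℝ) =
      (a + b * √2) ^ 2 - d * (c + e * √2) ^ 2 := by
  rw [relNorm_add_mul_sqrt _ (sqrt_mem_realBiquadField d)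
    (sqrt_notMem_realQuadField_two hd h2d) (sqrt_natCast_sq_mem _ d)
    (fun x hx ↦ exists_realQuadField_two_add_mul_sqrt hx) hx
    (mem_realQuadField_iff.mpr ⟨a, b, rfl⟩) (mem_realQuadField_iff.mpr ⟨c, e, rfl⟩)
    (by rw [h]; push_cast; ring), Real.sq_sqrt d.cast_nonneg]
  push_cast
  ring

theorem isIntegral_relNorm {F L : IntermediateField ℚ ℝ} (h : F ≤ L) (x : L)
    (hx : IsIntegral ℤ x) : IsIntegral ℤ (relNorm h x) := by
  let _ : Algebra F L := (IntermediateField.inclusion h).toRingHom.toAlgebra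
  exact Algebra.isIntegral_norm F hx

theorem relNorm_mem_unitSet {F L : IntermediateField ℚ ℝ} (h : F ≤ L) {x : ℝ}
    (hx : x ∈ unitSet L) :
    (relNorm h ⟨x, mem_of_mem_unitSet hx⟩ : ℝ) ∈ unitSet F := by
  obtain ⟨hL, h0, hi, hi'⟩ := mem_unitSet_iff.mp hx
  have hmul : relNorm h ⟨x, hL⟩ * relNorm h ⟨x⁻¹, inv_mem hL⟩ = 1 := by
    rw [← map_mul, ← map_one (relNorm h)]
    exact congrArg _ (Subtype.ext (mul_inv_cancel₀ h0))
  have hmul' := congrArg (Subtype.val) hmul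
  have hL' (y : L) (hy : IsIntegral ℤ (y : ℝ)) : IsIntegral ℤ y :=
    (isIntegral_algHom_iff (L.val.restrictScalars ℤ) Subtype.val_injective).mp hy
  have hF (y : F) (hy : IsIntegral ℤ y) : IsIntegral ℤ (y : ℝ) :=
    hy.map (F.val.restrictScalars ℤ)
  refine mem_unitSet_iff.mpr ⟨(relNorm h _).2, left_ne_zero_of_mul_eq_one hmul',
    hF _ (isIntegral_relNorm h _ (hL' _ hi)), ?_⟩
  rw [inv_eq_of_mul_eq_one_right hmul']
  exact hF _ (isIntegral_relNorm h _ (hL' _ hi'))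

/-- Up to a unit of `ℚ(√2)`, the square of a unit of `ℚ(√2, √d)` is the product of its norms to
`ℚ(√d)` and `ℚ(√(2d))`. -/
theorem exists_sq_mul_eq_mul (hd : ¬ IsSquare d) (h2d : ¬ IsSquare (2 * d)) {u : ℝ}
    (hu : u ∈ unitSet (realBiquadField d)) :
    ∃ x ∈ unitSet (realQuadField d), ∃ y ∈ unitSet (realQuadField (2 * d)),
      ∃ z ∈ unitSet (realQuadField 2), u ^ 2 * z = x * y := by
  obtain ⟨a, b, c, e, h⟩ := mem_realBiquadField_iff.mp (mem_of_mem_unitSet hu)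
  have h2 : √(2 : ℝ) ^ 2 = 2 := Real.sq_sqrt zero_le_two
  have hs : √(d : ℝ) ^ 2 = d := Real.sq_sqrt d.cast_nonneg
  have hx := relNorm_mem_unitSet (realQuadField_le d) hu
  have hy := relNorm_mem_unitSet (realQuadField_two_mul_le d) hu
  have hz := relNorm_mem_unitSet (realQuadField_two_le d) hu
  rw [relNorm_realQuadField hd h2d _ h] at hx
  rw [relNorm_realQuadField_two_mul hd h2d _ h] at hy
  rw [relNorm_realQuadField_two hd h2d _ h] at hz
  have hsq2 : ¬ IsSquare 2 := Nat.prime_two.prime.not_isSquare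
  obtain ⟨m, n, k, hk, hmn, hk'⟩ :=
    exists_eq_half_of_mem_unitSet Nat.prime_two.prime.squarefree hsq2 hz
  -- The product of the two norms is `u²` times the two conjugates of `u` under the automorphisms
  -- with `√2 ↦ -√2`. These conjugates multiply to the conjugate of the norm of `u` to `ℚ(√2)`,
  -- which is the chosen `z`.
  refine ⟨_, hx, _, hy, (m + (-n : ℤ) * √((2 : ℕ) : ℝ)) / 2,
    half_add_mul_sqrt_mem_unitSet hk (by rw [neg_sq]; exact hk'), ?_⟩
  have hcoord := (add_mul_sqrt_eq_zero_iff hsq2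
    (a := a ^ 2 + 2 * b ^ 2 - d * (c ^ 2 + 2 * e ^ 2) - m / 2)
    (b := 2 * a * b - 2 * d * c * e - n / 2)).mp (by
      push_cast at hmn ⊢
      linear_combination hmn - (b ^ 2 - d * e ^ 2 : ℝ) * h2)
  have hm : (m : ℝ) / 2 = a ^ 2 + 2 * b ^ 2 - d * (c ^ 2 + 2 * e ^ 2) := by
    have : (m : ℚ) / 2 = a ^ 2 + 2 * b ^ 2 - d * (c ^ 2 + 2 * e ^ 2) := by linarith
    exact_mod_cast this
  have hn : (n : ℝ) / 2 = 2 * a * b - 2 * d * c * e := by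
    have : (n : ℚ) / 2 = 2 * a * b - 2 * d * c * e := by linarith
    exact_mod_cast this
  set s := √(2 : ℝ)
  set t := √(d : ℝ)
  have hX : (a + c * t) ^ 2 - 2 * (b + e * t) ^ 2
      = u * (a - b * s + c * t - e * (s * t)) := by
    rw [h]
    linear_combination ((b + e * t) ^ 2 : ℝ) * h2
  have hY : (a + e * (s * t)) ^ 2 - 2 * (b + c / 2 * (s * t)) ^ 2
      = u * (a - b * s - c * t + e * (s * t)) := by
    rw [h]
    linear_combination (b ^ 2 - c ^ 2 / 2 * t ^ 2 : ℝ) * h2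
  have hZ : (m + (-n : ℤ) * √((2 : ℕ) : ℝ)) / 2
      = (a - b * s + c * t - e * (s * t)) * (a - b * s - c * t + e * (s * t)) := by
    push_cast
    change (m + -n * s) / 2 = _
    linear_combination hm - s * hn - (b ^ 2 - e ^ 2 * d : ℝ) * h2
      + (c ^ 2 + e ^ 2 * s ^ 2 - 2 * c * e * s : ℝ) * hs
  rw [hX, hY, hZ]
  ring

end Norms

/-- With `R = q₁q₂`, the roots are `(x√R + y√p)/2` and `a√2√p + b√R`. Changing the sign of `√p`
inverts the first, because `Rx² - py² = 4`; changing that of `√2√p` sends the second to its negative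
inverse, because `2pa² - Rb² = 1`. The code verifies the resulting norms in coordinates. -/
theorem AdmissiblePrimes.relNorm_sqrt_mul {p q₁ q₂ : ℕ} [hp : Fact p.Prime] [Fact q₁.Prime]
    [Fact q₂.Prime] (H : AdmissiblePrimes p q₁ q₂)
    (h : √(fundamentalUnit (p * q₁ * q₂) * fundamentalUnit (2 * (p * q₁ * q₂))) ∈
      realBiquadField (p * q₁ * q₂)) :
    (relNorm (realQuadField_le _) ⟨_, h⟩ : ℝ) = -fundamentalUnit (p * q₁ * q₂) ∧
    (relNorm (realQuadField_two_mul_le _) ⟨_, h⟩ : ℝ) =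
      fundamentalUnit (2 * (p * q₁ * q₂)) ∧
    (relNorm (realQuadField_two_le _) ⟨_, h⟩ : ℝ) = -1 := by
  obtain ⟨d₁, d₂, a, b, hd, -, hab, -, hsqrt, hcases⟩ := H.exists_sqrt_fundamentalUnit_two_mul
  obtain ⟨rfl, rfl⟩ := (H.sqrt_mul_mem_iff_eq hd hsqrt hcases).mp h
  obtain ⟨x, y, hxy, hsqrt'⟩ := H.exists_sqrt_fundamentalUnit
  have hε := Real.sq_sqrt (zero_le_one.trans H.one_lt_fundamentalUnit.le)
  have hε' := Real.sq_sqrt (zero_le_one.trans H.one_lt_fundamentalUnit_two_mul.le)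
  have hP := Real.sq_sqrt (p.cast_nonneg (α := ℝ))
  have hR := Real.sq_sqrt ((q₁ * q₂).cast_nonneg (α := ℝ))
  have h2 : √(2 : ℝ) ^ 2 = 2 := Real.sq_sqrt zero_le_two
  have ht : √((p * q₁ * q₂ : ℕ) : ℝ) = √(p : ℝ) * √((q₁ * q₂ : ℕ) : ℝ) := by
    rw [mul_assoc, sqrt_natCast_mul p]
  have hxy' : ((q₁ * q₂ : ℕ) : ℝ) * x ^ 2 = p * y ^ 2 + 4 := by exact_mod_cast hxy
  have hab' : 2 * p * a ^ 2 = ((q₁ * q₂ : ℕ) : ℝ) * b ^ 2 + 1 := by exact_mod_cast hab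
  have hD : ((p * q₁ * q₂ : ℕ) : ℝ) = p * (q₁ * q₂ : ℕ) := by push_cast; ring
  have hcoord : √(fundamentalUnit (p * q₁ * q₂) * fundamentalUnit (2 * (p * q₁ * q₂))) =
      (x * b * (q₁ * q₂ : ℕ) / 2 : ℚ) + (y * a * p / 2 : ℚ) * √2
        + (y * b / 2 : ℚ) * √((p * q₁ * q₂ : ℕ) : ℝ)
        + (x * a / 2 : ℚ) * (√2 * √((p * q₁ * q₂ : ℕ) : ℝ)) := by
    rw [Real.sqrt_mul (zero_le_one.trans H.one_lt_fundamentalUnit.le), hsqrt, hsqrt', ht,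
      sqrt_two_natCast_mul]
    generalize q₁ * q₂ = R at *
    push_cast
    linear_combination (x * b / 2 : ℝ) * hR + (y * a / 2 * √2 : ℝ) * hP
  have hns := H.not_isSquare
  have hns2 := H.not_isSquare_two_mul
  rw [relNorm_realQuadField hns hns2 h hcoord, relNorm_realQuadField_two_mul hns hns2 h hcoord,
    relNorm_realQuadField_two hns hns2 h hcoord, ht, hD]
  rw [← hε, ← hε', hsqrt, hsqrt', sqrt_two_natCast_mul]
  clear hcoord hsqrt hsqrt' hε hε' hcases
  generalize q₁ * q₂ = R at *
  push_cast
  generalize √(p : ℝ) = P at *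
  generalize √(R : ℝ) = S at *
  generalize √(2 : ℝ) = s at *
  rw [← hP, ← hR] at hxy' hab' ⊢
  refine ⟨?_, ?_, ?_⟩
  · linear_combination (-((x * S + y * P) ^ 2 / 4) : ℝ) * hab'
  · linear_combination ((a * s * P + b * S) ^ 2 / 4 : ℝ) * hxy'
      - (P ^ 2 * y ^ 2 / 8 * (b ^ 2 * S ^ 2 - 2 * a ^ 2 * P ^ 2) : ℝ) * h2
  · linear_combination ((b ^ 2 * S ^ 2 - a ^ 2 * P ^ 2 * s ^ 2) / 4 : ℝ) * hxy' - hab'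
      - (a ^ 2 * P ^ 2 : ℝ) * h2

/-! ### Fundamental systems of units -/

section FundamentalSystem

variable {L : IntermediateField ℚ ℝ}

/-- The units of a subfield of the real numbers, as real numbers. -/
noncomputable def realUnits (L : IntermediateField ℚ ℝ) : (𝓞 L)ˣ →* ℝˣ :=
  Units.map ((algebraMap L ℝ).comp (algebraMap (𝓞 L) L) : 𝓞 L →+* ℝ)

theorem coe_realUnits (u : (𝓞 L)ˣ) : (realUnits L u : ℝ) = (((u : 𝓞 L) : L) : ℝ) := rfl

theorem realUnits_injective : Function.Injective (realUnits L) := fun _ _ h ↦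
  Units.ext (RingOfIntegers.ext (Subtype.ext (congrArg Units.val h)))

/-- The only real roots of unity are `±1`, so torsion is exactly what absolute values ignore. -/
theorem mem_torsion_iff_abs_eq_one {ζ : (𝓞 L)ˣ} :
    ζ ∈ NumberField.Units.torsion L ↔ |(realUnits L ζ : ℝ)| = 1 := by
  rw [NumberField.Units.torsion, CommGroup.mem_torsion, isOfFinOrder_iff_pow_eq_one]
  constructor
  · rintro ⟨n, hn, h⟩
    have h' : (realUnits L ζ : ℝ) ^ n = 1 := by
      rw [← Units.val_pow_eq_pow_val, ← map_pow, h, map_one, Units.val_one]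
    rw [← pow_eq_one_iff_of_nonneg (abs_nonneg _) hn.ne', ← abs_pow, h', abs_one]
  · intro h
    refine ⟨2, two_pos, realUnits_injective (Units.ext ?_)⟩
    rw [map_pow, map_one, Units.val_pow_eq_pow_val, Units.val_one, ← sq_abs, h, one_pow]

variable {ι : Type*} [Fintype ι]

theorem coe_realUnits_prod_zpow {u : ι → (𝓞 L)ˣ} {v : ι → ℝ}
    (huv : ∀ i, (((u i : 𝓞 L) : L) : ℝ) = v i) (a : ι → ℤ) :
    (realUnits L (∏ i, u i ^ a i) : ℝ) = ∏ i, v i ^ a i := by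
  rw [map_prod, Units.coe_prod]
  refine Finset.prod_congr rfl fun i _ ↦ ?_
  rw [map_zpow, Units.val_zpow_eq_zpow_val, coe_realUnits, huv]

/-- Taking absolute values removes the torsion factor and leaves a question about products of
positive reals. -/
theorem isFundamentalSystemOfUnits_of {v : ι → ℝ} (hv : ∀ i, v i ∈ unitSet L)
    (hpos : ∀ i, 0 < v i) (hgen : ∀ w ∈ unitSet L, ∃ a : ι → ℤ, |w| = ∏ i, v i ^ a i)
    (hind : ∀ a : ι → ℤ, ∏ i, v i ^ a i = 1 → a = 0) : IsFundamentalSystemOfUnits L v := by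
  choose u hu using hv
  have hprod := coe_realUnits_prod_zpow hu
  have hpp (a : ι → ℤ) : 0 < ∏ i, v i ^ a i := Finset.prod_pos fun i _ ↦ zpow_pos (hpos i) _
  refine ⟨u, hu, fun w ↦ ?_⟩
  have habs {a : ι → ℤ} (h : ∃ ζ ∈ NumberField.Units.torsion L, w = ζ * ∏ i, u i ^ a i) :
      |(realUnits L w : ℝ)| = ∏ i, v i ^ a i := by
    obtain ⟨ζ, hζ, rfl⟩ := h
    rw [map_mul, Units.val_mul, abs_mul, mem_torsion_iff_abs_eq_one.mp hζ, one_mul, hprod,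
      abs_of_pos (hpp a)]
  obtain ⟨a, ha⟩ := hgen _ ⟨w, rfl⟩
  refine ⟨a, ⟨w * (∏ i, u i ^ a i)⁻¹, ?_, by rw [inv_mul_cancel_right]⟩, fun a' h' ↦ ?_⟩
  · rw [mem_torsion_iff_abs_eq_one, map_mul, map_inv, Units.val_mul, Units.val_inv_eq_inv_val,
      abs_mul, abs_inv, hprod, abs_of_pos (hpp a), coe_realUnits, ha, mul_inv_cancel₀ (hpp a).ne']
  · have h1 := habs h'
    rw [coe_realUnits, ha] at h1
    have h2 : a' - a = 0 := by
      apply hind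
      simp only [Pi.sub_apply]
      rw [Finset.prod_congr rfl fun i _ ↦ zpow_sub₀ (hpos i).ne' (a' i) (a i),
        Finset.prod_div_distrib, ← h1, div_self (hpp a).ne']
    exact sub_eq_zero.mp h2

theorem IsFundamentalSystemOfUnits.mem_unitSet {v : ι → ℝ}
    (h : IsFundamentalSystemOfUnits L v) (i : ι) : v i ∈ unitSet L := by
  obtain ⟨u, hu, -⟩ := h
  exact ⟨u i, hu i⟩

theorem IsFundamentalSystemOfUnits.exists_abs_eq {v : ι → ℝ}
    (h : IsFundamentalSystemOfUnits L v) {w : ℝ} (hw : w ∈ unitSet L) :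
    ∃ a : ι → ℤ, |w| = |∏ i, v i ^ a i| := by
  obtain ⟨u, hu, h⟩ := h
  obtain ⟨w, rfl⟩ := hw
  obtain ⟨a, ⟨ζ, hζ, rfl⟩, -⟩ := h w
  refine ⟨a, ?_⟩
  rw [← coe_realUnits, map_mul, Units.val_mul, abs_mul, mem_torsion_iff_abs_eq_one.mp hζ,
    one_mul, coe_realUnits_prod_zpow hu]

end FundamentalSystem

/-! ### Multiplicative relations between the fundamental units -/

theorem sqrt_sq_mem {L : IntermediateField ℚ ℝ} {x : ℝ} (hx : x ∈ L) : √(x ^ 2) ∈ L := by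
  rw [Real.sqrt_sq_eq_abs]
  rcases abs_choice x with h | h <;> rw [h]
  exacts [hx, neg_mem hx]

section Relations

variable {d : ℕ}

theorem fundamentalUnit_two_mem : fundamentalUnit 2 ∈ unitSet (realQuadField 2) :=
  (isLeast_fundamentalUnit Nat.prime_two.prime.squarefree Nat.prime_two.prime.not_isSquare).1.1

theorem one_lt_fundamentalUnit_two : 1 < fundamentalUnit 2 :=
  (isLeast_fundamentalUnit Nat.prime_two.prime.squarefree Nat.prime_two.prime.not_isSquare).1.2

/-- The norm from `ℚ(√2, √d)` to `ℚ(√d)` as a homomorphism with values in `ℝ`. -/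
noncomputable def relNormRealQuadField (hd : ¬ IsSquare d) (h2d : ¬ IsSquare (2 * d)) :
    realBiquadField d →*₀ ℝ where
  toFun x := relNorm (realQuadField_le d) x
  map_zero' := by
    have := relNorm_realQuadField hd h2d (zero_mem (realBiquadField d)) (a := 0) (b := 0)
      (c := 0) (e := 0) (by simp)
    exact this.trans (by simp)
  map_one' := by simp
  map_mul' x y := by simp

/-- The norm from `ℚ(√2, √d)` to `ℚ(√(2d))` as a homomorphism with values in `ℝ`. -/
noncomputable def relNormRealQuadFieldTwoMul (hd : ¬ IsSquare d) (h2d : ¬ IsSquare (2 * d)) :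
    realBiquadField d →*₀ ℝ where
  toFun x := relNorm (realQuadField_two_mul_le d) x
  map_zero' := by
    have := relNorm_realQuadField_two_mul hd h2d (zero_mem (realBiquadField d)) (a := 0)
      (b := 0) (c := 0) (e := 0) (by simp)
    exact this.trans (by simp)
  map_one' := by simp
  map_mul' x y := by simp

theorem relNorm_fundamentalUnit_two (hd : ¬ IsSquare d) (h2d : ¬ IsSquare (2 * d))
    (h : fundamentalUnit 2 ∈ realBiquadField d) :
    relNormRealQuadField hd h2d ⟨_, h⟩ = -1 ∧ relNormRealQuadFieldTwoMul hd h2d ⟨_, h⟩ = -1 := by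
  have hcoord : fundamentalUnit 2 = (1 : ℚ) + (1 : ℚ) * √2 + (0 : ℚ) * √(d : ℝ)
      + (0 : ℚ) * (√2 * √(d : ℝ)) := by
    rw [fundamentalUnit_two]; simp
  refine ⟨(relNorm_realQuadField hd h2d h hcoord).trans ?_,
    (relNorm_realQuadField_two_mul hd h2d h hcoord).trans ?_⟩ <;> norm_num

/-- The automorphism over `ℚ(√d)` fixes `x`, whereas the one over `ℚ(√(2d))` conjugates it, giving
its norm `1` over `ℚ`. -/
theorem relNorm_of_mem_realQuadField (hd : ¬ IsSquare d) (h2d : ¬ IsSquare (2 * d)) {m n : ℤ}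
    (hmn : m ^ 2 - d * n ^ 2 = 4) {x : ℝ} (h : x ∈ realBiquadField d)
    (hx : x = (m + n * √(d : ℝ)) / 2) :
    relNormRealQuadField hd h2d ⟨x, h⟩ = x ^ 2 ∧
      relNormRealQuadFieldTwoMul hd h2d ⟨x, h⟩ = 1 := by
  have h2 : √(2 : ℝ) ^ 2 = 2 := Real.sq_sqrt zero_le_two
  have hs : √(d : ℝ) ^ 2 = d := Real.sq_sqrt d.cast_nonneg
  have hmn' : (m : ℝ) ^ 2 - d * n ^ 2 = 4 := by exact_mod_cast hmn
  have hcoord : x = (m / 2 : ℚ) + (0 : ℚ) * √2 + (n / 2 : ℚ) * √(d : ℝ)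
      + (0 : ℚ) * (√2 * √(d : ℝ)) := by
    rw [hx]; push_cast; ring
  refine ⟨(relNorm_realQuadField hd h2d h hcoord).trans ?_,
    (relNorm_realQuadField_two_mul hd h2d h hcoord).trans ?_⟩
  · rw [hx]; push_cast; ring
  · push_cast
    linear_combination hmn' / 4 - (n ^ 2 / 8 * √(d : ℝ) ^ 2 : ℝ) * h2 - (n ^ 2 / 4 : ℝ) * hs

theorem relNorm_of_mem_realQuadField_two_mul (hd : ¬ IsSquare d) (h2d : ¬ IsSquare (2 * d))
    {m n : ℤ} (hmn : m ^ 2 - (2 * d : ℕ) * n ^ 2 = 4) {x : ℝ} (h : x ∈ realBiquadField d)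
    (hx : x = (m + n * √((2 * d : ℕ) : ℝ)) / 2) :
    relNormRealQuadField hd h2d ⟨x, h⟩ = 1 ∧
      relNormRealQuadFieldTwoMul hd h2d ⟨x, h⟩ = x ^ 2 := by
  have hs : √(d : ℝ) ^ 2 = d := Real.sq_sqrt d.cast_nonneg
  have hmn' : (m : ℝ) ^ 2 - 2 * d * n ^ 2 = 4 := by exact_mod_cast hmn
  have hcoord : x = (m / 2 : ℚ) + (0 : ℚ) * √2 + (0 : ℚ) * √(d : ℝ)
      + (n / 2 : ℚ) * (√2 * √(d : ℝ)) := by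
    rw [hx, sqrt_two_natCast_mul]; push_cast; ring
  refine ⟨(relNorm_realQuadField hd h2d h hcoord).trans ?_,
    (relNorm_realQuadField_two_mul hd h2d h hcoord).trans ?_⟩
  · push_cast
    linear_combination hmn' / 4 - (n ^ 2 / 2 : ℝ) * hs
  · rw [hx, sqrt_two_natCast_mul]; push_cast; ring

end Relations

namespace AdmissiblePrimes

variable {p q₁ q₂ : ℕ} [hp : Fact p.Prime] [hq₁ : Fact q₁.Prime] [hq₂ : Fact q₂.Prime]

theorem fundamentalUnit_mem (H : AdmissiblePrimes p q₁ q₂) :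
    fundamentalUnit (p * q₁ * q₂) ∈ unitSet (realBiquadField (p * q₁ * q₂)) ∧
    fundamentalUnit (2 * (p * q₁ * q₂)) ∈ unitSet (realBiquadField (p * q₁ * q₂)) ∧
    fundamentalUnit 2 ∈ unitSet (realBiquadField (p * q₁ * q₂)) :=
  ⟨unitSet_mono (realQuadField_le _)
      (isLeast_fundamentalUnit H.squarefree H.not_isSquare).1.1,
    unitSet_mono (realQuadField_two_mul_le _)
      (isLeast_fundamentalUnit H.squarefree_two_mul H.not_isSquare_two_mul).1.1,
    unitSet_mono (realQuadField_two_le _) fundamentalUnit_two_mem⟩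

/-- The norms of `ε_D ^ a * ε_{2D} ^ b * ε_2 ^ c` to `ℚ(√D)` and `ℚ(√(2D))`. -/
theorem relNorm_zpow_mul_zpow_mul_zpow (H : AdmissiblePrimes p q₁ q₂) {a b c : ℤ}
    {x : realBiquadField (p * q₁ * q₂)}
    (hx : (x : ℝ) = fundamentalUnit (p * q₁ * q₂) ^ a * fundamentalUnit (2 * (p * q₁ * q₂)) ^ b
      * fundamentalUnit 2 ^ c) :
    relNormRealQuadField H.not_isSquare H.not_isSquare_two_mul x =
        (fundamentalUnit (p * q₁ * q₂) ^ 2) ^ a * (-1) ^ c ∧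
      relNormRealQuadFieldTwoMul H.not_isSquare H.not_isSquare_two_mul x =
        (fundamentalUnit (2 * (p * q₁ * q₂)) ^ 2) ^ b * (-1) ^ c := by
  obtain ⟨h1, h2, h3⟩ := H.fundamentalUnit_mem
  have hx' : x = (⟨_, mem_of_mem_unitSet h1⟩ : realBiquadField (p * q₁ * q₂)) ^ a
      * (⟨_, mem_of_mem_unitSet h2⟩ : realBiquadField (p * q₁ * q₂)) ^ b
      * (⟨_, mem_of_mem_unitSet h3⟩ : realBiquadField (p * q₁ * q₂)) ^ c :=
    Subtype.ext (by rw [hx]; push_cast; rfl)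
  obtain ⟨m, n, -, hmn, hmn'⟩ := exists_fundamentalUnit_eq_of_prime_dvd (q := q₁) H.squarefree
    H.not_isSquare H.mod_q₁ ⟨p * q₂, by ring⟩
  obtain ⟨m', n', -, hmn2, hmn2'⟩ := exists_fundamentalUnit_eq_of_prime_dvd (q := q₁)
    H.squarefree_two_mul H.not_isSquare_two_mul H.mod_q₁ ⟨2 * (p * q₂), by ring⟩
  obtain ⟨e1, f1⟩ := relNorm_of_mem_realQuadField H.not_isSquare H.not_isSquare_two_mul
    (m := m) (n := n)
    (by rw [sub_eq_iff_eq_add']; exact_mod_cast hmn') (mem_of_mem_unitSet h1)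
    (by exact_mod_cast hmn)
  obtain ⟨e2, f2⟩ := relNorm_of_mem_realQuadField_two_mul H.not_isSquare H.not_isSquare_two_mul
    (m := m') (n := n')
    (by rw [sub_eq_iff_eq_add']; exact_mod_cast hmn2') (mem_of_mem_unitSet h2)
    (by exact_mod_cast hmn2)
  obtain ⟨e3, f3⟩ := relNorm_fundamentalUnit_two H.not_isSquare H.not_isSquare_two_mul
    (mem_of_mem_unitSet h3)
  rw [hx']
  simp only [map_mul, map_zpow₀, e1, e2, e3, f1, f2, f3, one_zpow, one_mul, mul_one, and_self]

/-- The norms to `K` and `K'` isolate, up to sign, the powers of `ε_D` and of `ε_{2D}`; a power of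
`ε_2` remains. -/
theorem eq_zero_of_zpow_mul_eq_one (H : AdmissiblePrimes p q₁ q₂) {a b c : ℤ}
    (h : fundamentalUnit (p * q₁ * q₂) ^ a * fundamentalUnit (2 * (p * q₁ * q₂)) ^ b
      * fundamentalUnit 2 ^ c = 1) : a = 0 ∧ b = 0 ∧ c = 0 := by
  obtain ⟨h1, h2⟩ := H.relNorm_zpow_mul_zpow_mul_zpow (x := 1) (a := a) (b := b) (c := c)
    (by rw [h]; rfl)
  have key {x : ℝ} (hx : 1 < x) {k : ℤ} (h : 1 = (x ^ 2) ^ k * (-1) ^ c) : k = 0 := by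
    have h' := congrArg abs h
    rw [abs_mul, abs_zpow (-1), abs_neg, abs_one, one_zpow, mul_one, abs_zpow, abs_sq] at h'
    have h1 : 1 < x ^ 2 := one_lt_pow₀ hx two_ne_zero
    exact zpow_right_injective₀ (zero_lt_one.trans h1) h1.ne' (by simpa using h'.symm)
  rw [map_one] at h1 h2
  obtain rfl := key H.one_lt_fundamentalUnit h1
  obtain rfl := key H.one_lt_fundamentalUnit_two_mul h2
  refine ⟨rfl, rfl, ?_⟩
  rw [zpow_zero, zpow_zero, one_mul, one_mul] at h
  exact zpow_right_injective₀ (zero_lt_one.trans one_lt_fundamentalUnit_two)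
    one_lt_fundamentalUnit_two.ne' (by simpa using h)

/-- The units of `ℚ(√2, √D)` are, up to sign, generated by the three fundamental units of the
quadratic subfields together with `√(ε_D ε_{2D})`, if the latter lies in the field. -/
theorem exists_abs_eq_of_mem_unitSet (H : AdmissiblePrimes p q₁ q₂) {u : ℝ}
    (hu : u ∈ unitSet (realBiquadField (p * q₁ * q₂))) : ∃ (i : ℕ) (a b c : ℤ),
      (i = 0 ∨ i = 1 ∧ √(fundamentalUnit (p * q₁ * q₂) * fundamentalUnit (2 * (p * q₁ * q₂))) ∈
        realBiquadField (p * q₁ * q₂)) ∧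
      |u| = √(fundamentalUnit (p * q₁ * q₂) * fundamentalUnit (2 * (p * q₁ * q₂))) ^ i *
        (fundamentalUnit (p * q₁ * q₂) ^ a * fundamentalUnit (2 * (p * q₁ * q₂)) ^ b
        * fundamentalUnit 2 ^ c) := by
  have hε0 := zero_lt_one.trans H.one_lt_fundamentalUnit
  have hε0' := zero_lt_one.trans H.one_lt_fundamentalUnit_two_mul
  have hε02 := zero_lt_one.trans one_lt_fundamentalUnit_two
  obtain ⟨x, hx, y, hy, z, hz, hxyz⟩ :=
    exists_sq_mul_eq_mul H.not_isSquare H.not_isSquare_two_mul hu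
  obtain ⟨a, ha⟩ := exists_zpow_of_mem_unitSet H.squarefree H.not_isSquare hx
  obtain ⟨b, hb⟩ := exists_zpow_of_mem_unitSet H.squarefree_two_mul H.not_isSquare_two_mul hy
  obtain ⟨c, hc⟩ := exists_zpow_of_mem_unitSet Nat.prime_two.prime.squarefree
    Nat.prime_two.prime.not_isSquare hz
  have hsq : u ^ 2 = fundamentalUnit (p * q₁ * q₂) ^ a *
      fundamentalUnit (2 * (p * q₁ * q₂)) ^ b * fundamentalUnit 2 ^ (-c) := by
    have := congrArg abs hxyz
    rw [abs_mul, abs_mul, ha, hb, hc, abs_sq] at this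
    rw [← this, mul_assoc, ← zpow_add₀ hε02.ne', add_neg_cancel, zpow_zero, mul_one]
  generalize -c = c at hsq
  have hK := mem_of_mem_unitSet hu
  -- The norm of `u²` to `K` is a square of a real number, but equals `ε_D^(2a) (-1)^c`.
  have hceven : Even c := by
    by_contra hodd
    rw [Int.not_even_iff_odd] at hodd
    have h1 := (H.relNorm_zpow_mul_zpow_mul_zpow (x := ⟨u, hK⟩ ^ 2) hsq).1
    rw [map_pow, hodd.neg_one_zpow] at h1
    have h2 : 0 < (fundamentalUnit (p * q₁ * q₂) ^ 2) ^ a := by positivity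
    have h3 := sq_nonneg (relNormRealQuadField H.not_isSquare H.not_isSquare_two_mul ⟨u, hK⟩)
    linarith
  obtain ⟨c, rfl⟩ := hceven
  obtain ⟨h1, h2, h3⟩ := H.fundamentalUnit_mem
  -- Dividing `u` by the even parts of the exponents exhibits `ε_D^i ε_{2D}^j` as a square in `K₁`;
  -- the parities `(0, 1)` and `(1, 0)` are then impossible.
  have hrep (i j : ℕ) (k l : ℤ) (ha : a = i + (k + k)) (hb : b = j + (l + l)) :
      √(fundamentalUnit (p * q₁ * q₂) ^ i * fundamentalUnit (2 * (p * q₁ * q₂)) ^ j) ∈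
        realBiquadField (p * q₁ * q₂) ∧
      |u| = √(fundamentalUnit (p * q₁ * q₂) ^ i * fundamentalUnit (2 * (p * q₁ * q₂)) ^ j) *
        (fundamentalUnit (p * q₁ * q₂) ^ k * fundamentalUnit (2 * (p * q₁ * q₂)) ^ l
        * fundamentalUnit 2 ^ c) := by
    set w := fundamentalUnit (p * q₁ * q₂) ^ k * fundamentalUnit (2 * (p * q₁ * q₂)) ^ l
        * fundamentalUnit 2 ^ c with hw
    have hw0 : 0 < w := by positivity
    have hwK : w ∈ realBiquadField (p * q₁ * q₂) :=
      mul_mem (mul_mem (zpow_mem (mem_of_mem_unitSet h1) k)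
        (zpow_mem (mem_of_mem_unitSet h2) l)) (zpow_mem (mem_of_mem_unitSet h3) c)
    have huw : fundamentalUnit (p * q₁ * q₂) ^ i * fundamentalUnit (2 * (p * q₁ * q₂)) ^ j
        = (u / w) ^ 2 := by
      rw [div_pow, eq_div_iff (by positivity), hsq, ha, hb, zpow_add₀ hε0.ne',
        zpow_add₀ hε0.ne', zpow_add₀ hε0'.ne', zpow_add₀ hε0'.ne', zpow_add₀ hε02.ne', hw,
        zpow_natCast, zpow_natCast]
      ring
    rw [huw]
    refine ⟨sqrt_sq_mem (div_mem hK hwK), ?_⟩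
    rw [Real.sqrt_sq_eq_abs, abs_div, abs_of_pos hw0, div_mul_cancel₀ _ hw0.ne']
  rcases Int.even_or_odd' a with ⟨k, ha | ha⟩ <;> rcases Int.even_or_odd' b with ⟨l, hb | hb⟩
  · obtain ⟨-, h⟩ := hrep 0 0 k l (by rw [ha]; push_cast; ring) (by rw [hb]; push_cast; ring)
    exact ⟨0, k, l, c, .inl rfl, by simpa using h⟩
  · obtain ⟨h, -⟩ := hrep 0 1 k l (by rw [ha]; push_cast; ring) (by rw [hb]; push_cast; ring)
    rw [pow_zero, one_mul, pow_one] at h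
    exact absurd h H.sqrt_fundamentalUnit_two_mul_notMem
  · obtain ⟨h, -⟩ := hrep 1 0 k l (by rw [ha]; push_cast; ring) (by rw [hb]; push_cast; ring)
    rw [pow_zero, mul_one, pow_one] at h
    exact absurd h H.sqrt_fundamentalUnit_notMem
  · obtain ⟨h, h'⟩ := hrep 1 1 k l (by rw [ha]; push_cast; ring) (by rw [hb]; push_cast; ring)
    rw [pow_one, pow_one] at h h'
    exact ⟨1, k, l, c, .inr ⟨rfl, h⟩, by rwa [pow_one]⟩

theorem xor_isFundamentalSystemOfUnits (H : AdmissiblePrimes p q₁ q₂) :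
    Xor
      (IsFundamentalSystemOfUnits (realBiquadField (p * q₁ * q₂))
        ![fundamentalUnit (p * q₁ * q₂), fundamentalUnit (2 * (p * q₁ * q₂)), fundamentalUnit 2])
      (IsFundamentalSystemOfUnits (realBiquadField (p * q₁ * q₂))
        ![√(fundamentalUnit (p * q₁ * q₂) * fundamentalUnit (2 * (p * q₁ * q₂))),
          fundamentalUnit (p * q₁ * q₂), fundamentalUnit 2]) := by
  have hε0 := zero_lt_one.trans H.one_lt_fundamentalUnit
  have hε0' := zero_lt_one.trans H.one_lt_fundamentalUnit_two_mul
  have hε02 := zero_lt_one.trans one_lt_fundamentalUnit_two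
  obtain ⟨h1, h2, h3⟩ := H.fundamentalUnit_mem
  have hsqrt0 := Real.sqrt_pos.mpr (mul_pos hε0 hε0')
  have hsq := Real.sq_sqrt (mul_pos hε0 hε0').le
  have hind := fun a b c ↦ H.eq_zero_of_zpow_mul_eq_one (a := a) (b := b) (c := c)
  have hrep := fun u hu ↦ H.exists_abs_eq_of_mem_unitSet (u := u) hu
  generalize fundamentalUnit (p * q₁ * q₂) = x at *
  generalize fundamentalUnit (2 * (p * q₁ * q₂)) = y at *
  generalize fundamentalUnit 2 = z at *
  by_cases hmem : √(x * y) ∈ realBiquadField (p * q₁ * q₂)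
  · have hunit : √(x * y) ∈ unitSet (realBiquadField (p * q₁ * q₂)) :=
      mem_unitSet_of_sq_mem hmem (by rw [hsq]; exact mul_mem_unitSet h1 h2)
    generalize √(x * y) = t at *
    refine .inr ⟨isFundamentalSystemOfUnits_of ?_ ?_ ?_ ?_, fun h ↦ ?_⟩
    · intro i; fin_cases i <;> assumption
    · intro i; fin_cases i <;> assumption
    · intro w hw
      obtain ⟨i, a, b, c, -, h⟩ := hrep w hw
      -- With `t² = xy`, the factor `y^b` is rewritten as `t^(2b) x^(-b)`.
      refine ⟨![i + (b + b), a - b, c], ?_⟩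
      rw [Fin.prod_univ_three, h]
      simp only [Matrix.cons_val]
      rw [zpow_add₀ hsqrt0.ne', zpow_add₀ hsqrt0.ne', ← mul_zpow, ← sq, hsq, mul_zpow,
        zpow_sub₀ hε0.ne', zpow_natCast]
      field_simp
    · intro a ha
      rw [Fin.prod_univ_three] at ha
      simp only [Matrix.cons_val] at ha
      have ht : t ^ a 0 * t ^ a 0 = x ^ a 0 * y ^ a 0 := by
        rw [← mul_zpow, ← sq, hsq, mul_zpow]
      -- Squaring the relation eliminates `t` in favour of `x` and `y`.
      obtain ⟨e1, e2, e3⟩ := hind (a 0 + (a 1 + a 1)) (a 0) (a 2 + a 2) (by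
        rw [zpow_add₀ hε0.ne', zpow_add₀ hε0.ne', zpow_add₀ hε02.ne']
        linear_combination (t ^ a 0 * x ^ a 1 * z ^ a 2 + 1) * ha
          - (x ^ a 1) ^ 2 * (z ^ a 2) ^ 2 * ht)
      ext i
      fin_cases i <;> simp <;> lia
    · obtain ⟨a, ha⟩ := h.exists_abs_eq hunit
      rw [Fin.prod_univ_three] at ha
      simp only [Matrix.cons_val] at ha
      have ha2 := congrArg (· ^ 2) ha
      simp only [sq_abs] at ha2
      rw [hsq] at ha2
      -- If the first system were fundamental, squaring the expression for `t` would give a relation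
      -- whose exponent of `x` is odd, yet it must vanish.
      obtain ⟨e1, -, -⟩ := hind (a 0 + a 0 - 1) (a 1 + a 1 - 1) (a 2 + a 2) (by
        rw [zpow_sub₀ hε0.ne', zpow_sub₀ hε0'.ne', zpow_add₀ hε0.ne', zpow_add₀ hε0'.ne',
          zpow_add₀ hε02.ne', zpow_one, zpow_one]
        field_simp
        linear_combination -ha2)
      lia
  · refine .inl ⟨isFundamentalSystemOfUnits_of ?_ ?_ ?_ ?_, fun h ↦ ?_⟩
    · intro i; fin_cases i <;> assumption
    · intro i; fin_cases i <;> assumption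
    · intro w hw
      obtain ⟨i, a, b, c, hi | ⟨-, hi⟩, h⟩ := hrep w hw
      · refine ⟨![a, b, c], ?_⟩
        rw [Fin.prod_univ_three, h, hi, pow_zero, one_mul]
        rfl
      · exact absurd hi hmem
    · intro a ha
      rw [Fin.prod_univ_three] at ha
      obtain ⟨e1, e2, e3⟩ := hind _ _ _ ha
      ext i
      fin_cases i <;> assumption
    · exact hmem (mem_of_mem_unitSet (h.mem_unitSet 0))

end AdmissiblePrimes

/-! ### The prime ideal above `p` and the main theorem -/

namespace AdmissiblePrimes

variable {p q₁ q₂ : ℕ} [hp : Fact p.Prime] [hq₁ : Fact q₁.Prime] [hq₂ : Fact q₂.Prime]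

/-- There is an integer of `ℚ(√D)` of norm `-p` whose square is associated with `p`. -/
theorem exists_sq_eq_mul_unit (H : AdmissiblePrimes p q₁ q₂) :
    ∃ (_ : NumberField (realQuadField (p * q₁ * q₂))) (α : 𝓞 (realQuadField (p * q₁ * q₂)))
      (u : (𝓞 (realQuadField (p * q₁ * q₂)))ˣ), α ^ 2 = p * u ∧ Algebra.norm ℤ α = -p := by
  obtain ⟨x, y, hxy, hε⟩ := H.exists_sqrt_fundamentalUnit
  obtain ⟨u, hu⟩ := (isLeast_fundamentalUnit H.squarefree H.not_isSquare).1.1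
  have hsq := Real.sq_sqrt (zero_le_one.trans H.one_lt_fundamentalUnit.le)
  have hP := Real.sq_sqrt (p.cast_nonneg (α := ℝ))
  have ht : √((p * q₁ * q₂ : ℕ) : ℝ) = √(p : ℝ) * √((q₁ * q₂ : ℕ) : ℝ) := by
    rw [mul_assoc, sqrt_natCast_mul p]
  -- This number is `√p · √ε_D` in coordinates; its norm `-p` comes from `q₁q₂x² - py² = 4`.
  have hint : IsIntegral ℤ (((p * y : ℤ) + (x : ℤ) * √((p * q₁ * q₂ : ℕ) : ℝ)) / 2 : ℝ) := by
    refine isIntegral_half_add_mul_sqrt (k := -p) ?_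
    have : ((q₁ * q₂ : ℕ) : ℤ) * x ^ 2 = p * y ^ 2 + 4 := by exact_mod_cast hxy
    push_cast at this ⊢
    linear_combination (-p : ℤ) * this
  set β : ℝ := ((p * y : ℤ) + (x : ℤ) * √((p * q₁ * q₂ : ℕ) : ℝ)) / 2 with hβ
  have hβK : β ∈ realQuadField (p * q₁ * q₂) := half_add_mul_sqrt_mem _ _ _
  obtain ⟨hfin, hn, -⟩ := norm_trace_realQuadField H.not_isSquare (x := ⟨β, hβK⟩)
    (a := p * y / 2) (b := x / 2) (hβ.trans (by push_cast; ring))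
  obtain ⟨α, hα⟩ : ∃ α : 𝓞 (realQuadField (p * q₁ * q₂)),
      (α : realQuadField (p * q₁ * q₂)) = ⟨β, hβK⟩ :=
    ⟨⟨_, (isIntegral_algHom_iff ((realQuadField (p * q₁ * q₂)).val.restrictScalars ℤ)
      Subtype.val_injective).mp hint⟩, rfl⟩
  have hK : NumberField (realQuadField (p * q₁ * q₂)) := { to_finiteDimensional := hfin }
  refine ⟨hK, α, u, RingOfIntegers.ext (Subtype.ext ?_), ?_⟩
  · have h1 : β ^ 2 = p * fundamentalUnit (p * q₁ * q₂) := by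
      rw [hβ, ← hsq, hε, ht]
      generalize q₁ * q₂ = R at *
      push_cast
      linear_combination (x ^ 2 / 4 * √(R : ℝ) ^ 2 - p * y ^ 2 / 4 : ℝ) * hP
    have h2 : ((α : realQuadField (p * q₁ * q₂)) : ℝ) ^ 2
        = p * ((u : 𝓞 (realQuadField (p * q₁ * q₂))) : realQuadField (p * q₁ * q₂)) := by
      rw [hα, hu]
      exact h1
    push_cast
    exact h2
  · have h2 : ((Algebra.norm ℤ α : ℤ) : ℚ) = -p := by
      rw [Algebra.coe_norm_int, hα, hn]
      have : ((q₁ * q₂ : ℕ) : ℚ) * x ^ 2 = p * y ^ 2 + 4 := by exact_mod_cast hxy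
      push_cast at this ⊢
      linear_combination (-p / 4 : ℚ) * this
    exact_mod_cast h2

/-- The ideal `(α)` has prime norm `p`, so it is prime and maximal. Since `α²` is `p` times a unit,
every prime above `p` contains `α` and so equals `(α)`. -/
theorem exists_unique_prime_over (H : AdmissiblePrimes p q₁ q₂) :
    ∃ P : Ideal (𝓞 (realQuadField (p * q₁ * q₂))),
      (∀ Q : Ideal (𝓞 (realQuadField (p * q₁ * q₂))),
        (Q.IsPrime ∧ Q.LiesOver (Ideal.span {(p : ℤ)})) ↔ Q = P) ∧ P.IsPrincipal := by
  obtain ⟨_, α, u, hα, hn⟩ := H.exists_sq_eq_mul_unit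
  have hnorm : Ideal.absNorm (Ideal.span {α}) = p := by
    rw [Ideal.absNorm_span_singleton, hn, Int.natAbs_neg, Int.natAbs_natCast]
  have hprime : (Ideal.span {α}).IsPrime := by
    refine Ideal.isPrime_of_irreducible_absNorm ?_
    rw [hnorm]
    exact hp.out
  have hne : Ideal.span {α} ≠ ⊥ := by
    intro h
    rw [h, Ideal.absNorm_bot] at hnorm
    exact hp.out.ne_zero hnorm.symm
  have hmax := hprime.isMaximal hne
  have hpmem : (p : 𝓞 (realQuadField (p * q₁ * q₂))) ∈ Ideal.span {α} := by
    rw [Ideal.mem_span_singleton]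
    refine ⟨α * (u⁻¹ : (𝓞 (realQuadField (p * q₁ * q₂)))ˣ), ?_⟩
    linear_combination (-((u⁻¹ : (𝓞 (realQuadField (p * q₁ * q₂)))ˣ) :
      𝓞 (realQuadField (p * q₁ * q₂)))) * hα - (p : 𝓞 (realQuadField (p * q₁ * q₂))) * u.mul_inv
  have hover : (Ideal.span {α}).LiesOver (Ideal.span {(p : ℤ)}) := by
    constructor
    have hpm : (Ideal.span {(p : ℤ)}).IsMaximal :=
      PrincipalIdealRing.isMaximal_of_irreducible (Nat.prime_iff_prime_int.mp hp.out).irreducible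
    refine hpm.eq_of_le (Ideal.IsPrime.ne_top inferInstance) ?_
    rw [Ideal.span_singleton_le_iff_mem, Ideal.mem_comap]
    simpa using hpmem
  refine ⟨Ideal.span {α}, fun Q ↦ ⟨fun ⟨hQ, hQp⟩ ↦ ?_, ?_⟩, ⟨α, rfl⟩⟩
  · refine (hmax.eq_of_le hQ.ne_top ?_).symm
    rw [Ideal.span_singleton_le_iff_mem]
    have h1 : (p : 𝓞 (realQuadField (p * q₁ * q₂))) ∈ Q := by
      have := hQp.over ▸ Ideal.mem_span_singleton_self (p : ℤ)
      rw [Ideal.mem_comap] at this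
      simpa using this
    exact hQ.mem_of_pow_mem 2 (hα ▸ Q.mul_mem_right _ h1)
  · rintro rfl
    exact ⟨hprime, hover⟩

end AdmissiblePrimes

theorem mainTheorem5 (p q₁ q₂ D : ℕ) [Fact p.Prime] [Fact q₁.Prime] [Fact q₂.Prime]
    (hp : p % 8 = 5) (hq₁ : q₁ % 8 = 3) (hq₂ : q₂ % 8 = 3) (hq : q₁ ≠ q₂)
    (hpq₁ : legendreSym q₁ (p : ℤ) = -1) (hpq₂ : legendreSym q₂ (p : ℤ) = -1)
    (hD : D = p * q₁ * q₂) :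
    -- there is exactly one prime ideal of `K` above `p`, and it is principal
    (∃ P : Ideal (𝓞 (realQuadField D)),
      (∀ Q : Ideal (𝓞 (realQuadField D)),
        (Q.IsPrime ∧ Q.LiesOver (Ideal.span {(p : ℤ)})) ↔ Q = P) ∧
      P.IsPrincipal) ∧
    -- exactly one of the two systems is a fundamental system of units of `K₁`
    Xor
      (IsFundamentalSystemOfUnits (realBiquadField D)
        ![fundamentalUnit D, fundamentalUnit (2 * D), fundamentalUnit 2])
      (IsFundamentalSystemOfUnits (realBiquadField D)
        ![√(fundamentalUnit D * fundamentalUnit (2 * D)), fundamentalUnit D,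
          fundamentalUnit 2]) ∧
    -- the criterion for `√(ε_D ε_{2D}) ∈ K₁`
    (∃ r s : ℤ, fundamentalUnit (2 * D) = r + s * √((2 * D : ℕ) : ℝ) ∧
      (√(fundamentalUnit D * fundamentalUnit (2 * D)) ∈ realBiquadField D ↔
        IsSquare ((p : ℤ) * (r + 1)))) ∧
    -- the norms of `√(ε_D ε_{2D})` to `K`, `K'` and `ℚ₁`
    (∀ h : √(fundamentalUnit D * fundamentalUnit (2 * D)) ∈ realBiquadField D,
      (relNorm (realQuadField_le D) ⟨_, h⟩ : ℝ) = -fundamentalUnit D ∧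
      (relNorm (realQuadField_two_mul_le D) ⟨_, h⟩ : ℝ) = fundamentalUnit (2 * D) ∧
      (relNorm (realQuadField_two_le D) ⟨_, h⟩ : ℝ) = -1) := by
  have H : AdmissiblePrimes p q₁ q₂ := ⟨hp, hq₁, hq₂, hq, hpq₁, hpq₂⟩
  subst hD
  exact ⟨H.exists_unique_prime_over, H.xor_isFundamentalSystemOfUnits,
    H.exists_sqrt_mul_mem_iff_isSquare, fun h ↦ H.relNorm_sqrt_mul h⟩
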